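/- For $f\colon\{-1,1\}^n\to\{0,1\}$ let $\mathbb{E}[f]$ be the expectation of $f(x)$ for $x$ uniformly distributed in $\{-1,1\}^n$, and for $1\le k\le n$ let $I_k(f)=\Pr_x[f(x)\ne f(x\oplus e_k)]$ be the influence of the $k$th coordinate, where $x\oplus e_k$ is obtained from $x$ by flipping the $k$th coordinate. There exist universal constants $c_1,c_2>0$ such that the following holds. For every $n\ge 1$, every $t\in\mathbb{R}$ and every $a\in\mathbb{R}^n$ with $a_1\ge a_2\ge\dots\ge a_n\ge 0$ and $\sum_{i=1}^n a_i^2=1$, if the halfspace $f(x)=\mathbf{1}\left(\sum_{i=1}^n a_ix_i>t\right)$ on $\{-1,1\}^n$ satisfies $\mathbb{E}[f]\le\frac12$, then $$c_1\,\mathbb{E}[f]\,\min\left\{1,\,a_1\sqrt{\log(1/\mathbb{E}[f])}\right\}\;\le\;\max_{1\le i\le n} I_i(f)\;\le\; c_2\,\mathbb{E}[f]\,\min\left\{1,\,a_1\sqrt{\log(1/\mathbb{E}[f])}\right\},$$ where $\log$ is the natural logarithm (and, if $\mathbb{E}[f]=0$, the outer terms are read as $0$). -/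

import Mathlib

/-- The discrete cube `{-1,1}^n`; the two elements of `ℤˣ` are `1` and `-1`. -/
abbrev Cube (n : ℕ) : Type := Fin n → ℤˣ

/-- The point `x ⊕ e_k`, obtained from `x` by flipping the `k`th coordinate. -/
def flipCoord {n : ℕ} (k : Fin n) (x : Cube n) : Cube n :=
  Function.update x k (-x k)

/-- The probability of the event `A` when `x` is uniformly distributed in `{-1,1}^n`. -/
noncomputable def cubeProb {n : ℕ} (A : Cube n → Prop) [DecidablePred A] : ℝ :=
  ((Finset.univ.filter A).card : ℝ) / 2 ^ n

/-- The expectation `E[f]` with respect to the uniform distribution on `{-1,1}^n`. -/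
noncomputable def cubeMean {n : ℕ} (f : Cube n → ℝ) : ℝ :=
  (∑ x : Cube n, f x) / 2 ^ n

/-- The halfspace `𝟙(∑ i, a i * x i > t)`, a function from `{-1,1}^n` to `{0,1}`. -/
noncomputable def halfspace {n : ℕ} (a : Fin n → ℝ) (t : ℝ) (x : Cube n) : ℝ :=
  if ∑ i, a i * ((x i : ℤ) : ℝ) > t then 1 else 0

/-- The influence `I_k(f) = Pr[f(x) ≠ f(x ⊕ e_k)]`. -/
noncomputable def influence {n : ℕ} (f : Cube n → ℝ) (k : Fin n) : ℝ :=
  cubeProb fun x => f x ≠ f (flipCoord k x)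

/-- The maximal influence `max_i I_i(f)`. -/
noncomputable def maxInfluence {n : ℕ} [NeZero n] (f : Cube n → ℝ) : ℝ :=
  Finset.univ.sup' Finset.univ_nonempty (influence f)

open Finset

noncomputable section

/-! Write S = ∑ a_i x_i, p = P(S > t) and L = √log(1/p); by symmetry t ≥ 0 may be assumed. A
coordinate of weight a_i is pivotal only when S is within 2a_i of t. So the question is how much
mass a window of length about 2a_1 at t carries, where a_1 is the largest weight, and 1/L is the
scale on which the tail of S changes.

Lower bound: a logarithmic Sobolev inequality (`prob_linForm_gt_add_mul_log_le`) shows that the tail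
at least halves over a distance 6/L, so (t, t + 6/L] has mass at least p/2. About 3/(a_1 L) windows
of length 2a_1 cover it (one if this is small), and each has mass at most 16 times the first
influence (`prob_window_le_sixteen_mul_influence`). Indeed, once the first coordinate is removed, no
window farther out is much heavier than the one centred at t (`prob_far_window_le`), by reflection
and by flipping one large coordinate.

Upper bound: it is immediate unless a_1 L is small. In that case the interval of length 1/(32L)
below t has mass at most 5p (`prob_below_le`), because raising random coordinates carries most of it
above t at bounded cost in density. Reflection sends the window above t into each of about 1/(128
a_1 L) disjoint windows of that interval, so its mass is O(p a_1 L). If t is too close to 0 to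
reflect, then p ≥ 1/7 and the anticoncentration bound `prob_abs_linForm_sub_le` suffices. -/

/-! ### Probability on the cube -/

/-- The linear form `∑ i, a i * x i` on the cube. -/
def linForm {n : ℕ} (a : Fin n → ℝ) (x : Cube n) : ℝ := ∑ i, a i * ((x i : ℤ) : ℝ)

open Classical in
/-- `cubeProb`, with classical decidability. -/
def prob {n : ℕ} (A : Cube n → Prop) : ℝ := cubeProb A

lemma cubeProb_eq_prob {n : ℕ} (A : Cube n → Prop) [DecidablePred A] : cubeProb A = prob A := by
  unfold prob
  congr

lemma prob_eq_cubeMean {n : ℕ} (A : Cube n → Prop) [DecidablePred A] :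
    prob A = cubeMean fun x => if A x then 1 else 0 := by
  rw [← cubeProb_eq_prob]
  simp [cubeProb, cubeMean]

lemma prob_nonneg {n : ℕ} (A : Cube n → Prop) : 0 ≤ prob A := by
  unfold prob cubeProb; positivity

lemma card_cube (n : ℕ) : Fintype.card (Cube n) = 2 ^ n := by
  simp [Cube]

lemma cubeMean_mono {n : ℕ} {f g : Cube n → ℝ} (h : ∀ x, f x ≤ g x) : cubeMean f ≤ cubeMean g := by
  unfold cubeMean
  gcongr
  exact h _

lemma cubeMean_const {n : ℕ} (c : ℝ) : cubeMean (fun _ : Cube n => c) = c := by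
  have : (2 : ℝ) ^ n ≠ 0 := by positivity
  simp only [cubeMean, sum_const, card_univ, card_cube, nsmul_eq_mul]
  push_cast
  field_simp

lemma cubeMean_add {n : ℕ} (f g : Cube n → ℝ) :
    cubeMean (fun x => f x + g x) = cubeMean f + cubeMean g := by
  simp [cubeMean, sum_add_distrib, add_div]

lemma cubeMean_mul_left {n : ℕ} (c : ℝ) (f : Cube n → ℝ) :
    cubeMean (fun x => c * f x) = c * cubeMean f := by
  simp [cubeMean, ← mul_sum, mul_div_assoc]

lemma prob_mono {n : ℕ} {A B : Cube n → Prop} (h : ∀ x, A x → B x) : prob A ≤ prob B := by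
  classical
  unfold prob cubeProb
  refine div_le_div_of_nonneg_right (Nat.cast_le.2 (card_le_card ?_)) (by positivity)
  exact monotone_filter_right _ fun x _ hx => h x hx

lemma prob_le_add {n : ℕ} {A B C : Cube n → Prop} (h : ∀ x, A x → B x ∨ C x) :
    prob A ≤ prob B + prob C := by
  classical
  rw [prob_eq_cubeMean, prob_eq_cubeMean, prob_eq_cubeMean, ← cubeMean_add]
  refine cubeMean_mono fun x => ?_
  by_cases hA : A x
  · rcases h x hA with hB | hC
    · by_cases hC : C x <;> simp [hA, hB, hC]
    · by_cases hB : B x <;> simp [hA, hB, hC]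
  · by_cases hB : B x <;> by_cases hC : C x <;> simp [hA, hB, hC]

lemma prob_true {n : ℕ} : prob (fun _ : Cube n => True) = 1 := by
  rw [prob_eq_cubeMean]
  simpa using cubeMean_const (n := n) 1

lemma prob_le_one {n : ℕ} (A : Cube n → Prop) : prob A ≤ 1 :=
  (prob_mono fun _ _ => trivial).trans_eq prob_true

lemma prob_le_of_injOn {n : ℕ} {A B : Cube n → Prop} (φ : Cube n → Cube n)
    (hφ : ∀ x, A x → B (φ x)) (hinj : ∀ x y, A x → A y → φ x = φ y → x = y) :
    prob A ≤ prob B := by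
  classical
  unfold prob cubeProb
  refine div_le_div_of_nonneg_right (Nat.cast_le.2 ?_) (by positivity)
  refine Finset.card_le_card_of_injOn φ (fun x hx => ?_) (fun x hx y hy h => ?_)
  · simpa using hφ x (by simpa using hx)
  · exact hinj x y (by simpa using hx) (by simpa using hy) h

/-- Disjoint events contained in a common event. -/
lemma sum_prob_le {n : ℕ} {ι : Type*} (s : Finset ι) (A : ι → Cube n → Prop) (B : Cube n → Prop)
    (hAB : ∀ k ∈ s, ∀ x, A k x → B x)
    (hd : ∀ k ∈ s, ∀ l ∈ s, ∀ x, A k x → A l x → k = l) :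
    ∑ k ∈ s, prob (A k) ≤ prob B := by
  classical
  unfold prob cubeProb
  rw [← sum_div]
  gcongr
  rw [← Nat.cast_sum, ← card_biUnion]
  · gcongr
    intro x hx
    simp only [mem_biUnion, mem_filter, mem_univ, true_and] at hx ⊢
    obtain ⟨k, hk, hx⟩ := hx
    exact hAB k hk x hx
  · intro k hk l hl hkl
    rw [Function.onFun, disjoint_left]
    intro x hx hx'
    exact hkl (hd k hk l hl x (by simpa using hx) (by simpa using hx'))

lemma prob_le_sum {n : ℕ} {ι : Type*} (s : Finset ι) (A : ι → Cube n → Prop) (B : Cube n → Prop)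
    (hB : ∀ x, B x → ∃ k ∈ s, A k x) : prob B ≤ ∑ k ∈ s, prob (A k) := by
  classical
  unfold prob cubeProb
  rw [← sum_div]
  gcongr
  rw [← Nat.cast_sum]
  refine Nat.cast_le.2 (le_trans (card_le_card (t := s.biUnion fun k => univ.filter (A k)) ?_)
    card_biUnion_le)
  intro x hx
  simpa using hB x (by simpa using hx)

/-! ### Product formulas, the Chernoff bound and flips -/

lemma sum_units {M : Type*} [AddCommMonoid M] (F : ℤˣ → M) : ∑ u, F u = F 1 + F (-1) := by
  have : (univ : Finset ℤˣ) = {1, -1} := rfl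
  rw [this, sum_pair (by decide)]

lemma sum_cube_prod {R : Type*} [CommRing R] {n : ℕ} (F : Fin n → ℤˣ → R) :
    ∑ x : Cube n, ∏ i, F i (x i) = ∏ i, (F i 1 + F i (-1)) := by
  simp_rw [← sum_units]
  exact (Fintype.prod_sum F).symm

lemma cubeMean_exp_linForm_le {n : ℕ} (b : Fin n → ℝ) (θ : ℝ) :
    cubeMean (fun x => Real.exp (θ * linForm b x)) ≤ Real.exp (θ ^ 2 / 2 * ∑ i, b i ^ 2) := by
  have h1 : ∀ x : Cube n, Real.exp (θ * linForm b x)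
      = ∏ i, Real.exp (θ * b i * ((x i : ℤ) : ℝ)) := fun x => by
    rw [← Real.exp_sum, linForm, mul_sum]
    simp only [mul_assoc]
  unfold cubeMean
  simp_rw [h1]
  rw [sum_cube_prod (fun i u => Real.exp (θ * b i * ((u : ℤ) : ℝ))), mul_sum, Real.exp_sum]
  have h2 : (2 : ℝ) ^ n = ∏ _i : Fin n, (2 : ℝ) := by simp
  rw [h2, ← prod_div_distrib]
  refine prod_le_prod (fun i _ => by positivity) fun i _ => ?_
  have h3 := Real.cosh_le_exp_half_sq (θ * b i)
  rw [Real.cosh_eq] at h3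
  rw [show θ ^ 2 / 2 * b i ^ 2 = (θ * b i) ^ 2 / 2 by ring]
  simpa using h3

/-- Chernoff's bound with θ left free: it serves both for S and for the squared weights. -/
lemma prob_linForm_gt_le {n : ℕ} (b : Fin n → ℝ) (s : ℝ) {θ : ℝ} (hθ : 0 ≤ θ) :
    prob (fun x => s < linForm b x) ≤ Real.exp (-(θ * s) + θ ^ 2 / 2 * ∑ i, b i ^ 2) := by
  classical
  rw [prob_eq_cubeMean, Real.exp_add]
  calc _ ≤ cubeMean fun x => Real.exp (-(θ * s)) * Real.exp (θ * linForm b x) := by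
        refine cubeMean_mono fun x => ?_
        rw [← Real.exp_add]
        split_ifs with h
        · rw [Real.one_le_exp_iff]
          nlinarith
        · positivity
    _ ≤ _ := by
        rw [cubeMean_mul_left]
        gcongr
        exact cubeMean_exp_linForm_le b θ

lemma flipCoord_flipCoord {n : ℕ} (k : Fin n) (x : Cube n) : flipCoord k (flipCoord k x) = x := by
  simp [flipCoord]

/-- Flipping a coordinate, as a permutation of the cube. -/
def flipEquiv {n : ℕ} (k : Fin n) : Cube n ≃ Cube n :=
  Function.Involutive.toPerm (flipCoord k) (flipCoord_flipCoord k)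

lemma linForm_flipCoord {n : ℕ} (a : Fin n → ℝ) (k : Fin n) (x : Cube n) :
    linForm a (flipCoord k x) = linForm a x - 2 * a k * ((x k : ℤ) : ℝ) := by
  unfold linForm
  rw [← add_sum_erase _ _ (mem_univ k), ← add_sum_erase univ (fun i => a i * ((x i : ℤ) : ℝ)) (mem_univ k)]
  have : ∀ i ∈ univ.erase k, a i * ((flipCoord k x i : ℤ) : ℝ) = a i * ((x i : ℤ) : ℝ) := fun i hi => by
    rw [flipCoord, Function.update_of_ne (ne_of_mem_erase hi)]
  rw [sum_congr rfl this]
  simp [flipCoord]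
  ring

lemma linForm_neg {n : ℕ} (a : Fin n → ℝ) (x : Cube n) : linForm a (-x) = -linForm a x := by
  simp [linForm]

lemma unit_cast_sq (u : ℤˣ) : (((u : ℤ) : ℝ)) ^ 2 = 1 := by
  rcases Int.units_eq_one_or u with rfl | rfl <;> simp

/-! ### Logarithmic Sobolev inequality and decay of the tail -/

/-- With S = (M + N)/2 and T = u² + v², split M/S as 2u²/T times the quotient, likewise N/S with v,
and apply log z ≤ z - 1 to every factor. The quotients cancel in total, and the rest is (u² - v²)²/T
≤ 2(u - v)². -/
lemma two_point_entropy_le {u v M N : ℝ} (hM : 0 < M) (hN : 0 < N) :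
    u ^ 2 * Real.log M + v ^ 2 * Real.log N
      ≤ 2 * (u - v) ^ 2 + (u ^ 2 + v ^ 2) * Real.log ((M + N) / 2) := by
  set S := (M + N) / 2 with hS
  have hS0 : 0 < S := by positivity
  have key : ∀ {w T L : ℝ}, 0 < L → 0 < T → 0 < w →
      w ^ 2 * (Real.log L - Real.log S) ≤
        w ^ 2 * (2 * w ^ 2 / T - 1) + (T / 2 * (L / S) - w ^ 2) := by
    intro w T L hL hT hw
    have e : Real.log L - Real.log S
        = Real.log (2 * w ^ 2 / T) + Real.log ((L / S) / (2 * w ^ 2 / T)) := by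
      rw [← Real.log_mul (by positivity) (by positivity), ← Real.log_div hL.ne' hS0.ne']
      congr 1
      field_simp
    have h1 := Real.log_le_sub_one_of_pos (show 0 < 2 * w ^ 2 / T by positivity)
    have h2 := Real.log_le_sub_one_of_pos (show 0 < (L / S) / (2 * w ^ 2 / T) by positivity)
    rw [e]
    calc w ^ 2 * (Real.log (2 * w ^ 2 / T) + Real.log ((L / S) / (2 * w ^ 2 / T)))
        ≤ w ^ 2 * ((2 * w ^ 2 / T - 1) + ((L / S) / (2 * w ^ 2 / T) - 1)) := by gcongr
      _ = _ := by field_simp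
  have zero : ∀ {w L K : ℝ}, 0 < L → 0 < K → S = (L + K) / 2 →
      w ^ 2 * (Real.log L - Real.log S) ≤ 2 * w ^ 2 := by
    intro w L K hL hK e
    rw [← Real.log_div hL.ne' hS0.ne']
    have h1 := Real.log_le_sub_one_of_pos (show 0 < L / S by positivity)
    have : L / S ≤ 2 := by
      rw [div_le_iff₀ hS0, e]; linarith
    nlinarith [sq_nonneg w]
  suffices H : ∀ u v : ℝ, 0 ≤ u → 0 ≤ v → u ^ 2 * (Real.log M - Real.log S) +
      v ^ 2 * (Real.log N - Real.log S) ≤ 2 * (u - v) ^ 2 by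
    have h1 := H |u| |v| (abs_nonneg _) (abs_nonneg _)
    have h2 : (|u| - |v|) ^ 2 ≤ (u - v) ^ 2 := sq_le_sq.2 (abs_abs_sub_abs_le u v)
    simp only [sq_abs] at h1
    nlinarith
  intro u v hu hv
  rcases hu.eq_or_lt with rfl | hu
  · have := zero (w := v) hN hM (by rw [hS]; ring)
    nlinarith
  rcases hv.eq_or_lt with rfl | hv
  · have := zero (w := u) hM hN (by rw [hS])
    nlinarith
  have hT : 0 < u ^ 2 + v ^ 2 := by positivity
  have h1 := key hM hT hu
  have h2 := key hN hT hv
  have h3 : (u ^ 2 + v ^ 2) / 2 * (M / S) + (u ^ 2 + v ^ 2) / 2 * (N / S) = u ^ 2 + v ^ 2 := by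
    have : M / S + N / S = 2 := by
      rw [← add_div, div_eq_iff hS0.ne', hS]; ring
    rw [← mul_add, this]; ring
  have h4 : u ^ 2 * (2 * u ^ 2 / (u ^ 2 + v ^ 2) - 1) + v ^ 2 * (2 * v ^ 2 / (u ^ 2 + v ^ 2) - 1)
      = (u - v) ^ 2 * ((u + v) ^ 2 / (u ^ 2 + v ^ 2)) := by
    field_simp; ring
  have h5 : (u + v) ^ 2 / (u ^ 2 + v ^ 2) ≤ 2 := by
    rw [div_le_iff₀ hT]; nlinarith [sq_nonneg (u - v)]
  have h6 := mul_le_mul_of_nonneg_left h5 (sq_nonneg (u - v))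
  linarith

lemma sum_cube_succ {M : Type*} [AddCommMonoid M] {n : ℕ} (F : Cube (n + 1) → M) :
    ∑ x, F x = ∑ x : Cube n, F (Fin.cons 1 x) + ∑ x : Cube n, F (Fin.cons (-1) x) := by
  rw [← (Fin.consEquiv (fun _ : Fin (n + 1) => ℤˣ)).sum_comp, Fintype.sum_prod_type, sum_units]
  rfl

lemma flipCoord_zero_cons {n : ℕ} (u : ℤˣ) (x : Cube n) :
    flipCoord 0 (Fin.cons u x : Cube (n + 1)) = Fin.cons (-u) x := by
  simp [flipCoord]

lemma flipCoord_succ_cons {n : ℕ} (i : Fin n) (u : ℤˣ) (x : Cube n) :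
    flipCoord i.succ (Fin.cons u x : Cube (n + 1)) = Fin.cons u (flipCoord i x) := by
  simp [flipCoord, Fin.cons_update]

/-- The sum over all vertices of the squared discrete gradient. -/
def dirichlet {n : ℕ} (g : Cube n → ℝ) : ℝ := ∑ x, ∑ i, (g x - g (flipCoord i x)) ^ 2

lemma dirichlet_succ {n : ℕ} (g : Cube (n + 1) → ℝ) :
    dirichlet g = dirichlet (fun x => g (Fin.cons 1 x)) + dirichlet (fun x => g (Fin.cons (-1) x))
      + 2 * ∑ x, (g (Fin.cons 1 x) - g (Fin.cons (-1) x)) ^ 2 := by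
  unfold dirichlet
  rw [sum_cube_succ]
  simp only [Fin.sum_univ_succ, flipCoord_zero_cons, flipCoord_succ_cons, neg_neg, sum_add_distrib]
  have : ∀ x : Cube n, (g (Fin.cons (-1) x) - g (Fin.cons 1 x)) ^ 2
      = (g (Fin.cons 1 x) - g (Fin.cons (-1) x)) ^ 2 := fun x => by ring
  simp only [this]
  ring

/-- The reverse triangle inequality in ℓ². It bounds the gap between the norms of g on two
half-cubes by the gradient across the first coordinate. -/
lemma sq_sub_sqrt_sum_sq_le {ι : Type*} (s : Finset ι) (f g : ι → ℝ) :
    (√(∑ i ∈ s, f i ^ 2) - √(∑ i ∈ s, g i ^ 2)) ^ 2 ≤ ∑ i ∈ s, (f i - g i) ^ 2 := by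
  have hf : 0 ≤ ∑ i ∈ s, f i ^ 2 := by positivity
  have hg : 0 ≤ ∑ i ∈ s, g i ^ 2 := by positivity
  have h := Real.sum_mul_le_sqrt_mul_sqrt s f g
  have e : ∑ i ∈ s, (f i - g i) ^ 2
      = ∑ i ∈ s, f i ^ 2 + ∑ i ∈ s, g i ^ 2 - 2 * ∑ i ∈ s, f i * g i := by
    rw [mul_sum, ← sum_add_distrib, ← sum_sub_distrib]
    exact sum_congr rfl fun i _ => by ring
  rw [e, sub_sq, Real.sq_sqrt hf, Real.sq_sqrt hg]
  linarith

/-- The logarithmic Sobolev inequality on the cube, in variational form. -/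
lemma sum_sq_mul_log_le {n : ℕ} (g w : Cube n → ℝ) (hw : ∀ x, 0 < w x) :
    ∑ x, g x ^ 2 * Real.log (w x) ≤ dirichlet g + (∑ x, g x ^ 2) * Real.log (cubeMean w) := by
  induction n with
  | zero => simp [dirichlet, cubeMean]
  | succ n ih =>
    have h1 := ih (fun x => g (Fin.cons 1 x)) (fun x => w (Fin.cons 1 x)) fun x => hw _
    have h2 := ih (fun x => g (Fin.cons (-1) x)) (fun x => w (Fin.cons (-1) x)) fun x => hw _
    have pos : ∀ u : ℤˣ, 0 < cubeMean (fun x : Cube n => w (Fin.cons u x)) := fun u =>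
      div_pos (sum_pos (fun x _ => hw _) univ_nonempty) (by positivity)
    have h3 := two_point_entropy_le (u := √(∑ x : Cube n, g (Fin.cons 1 x) ^ 2))
      (v := √(∑ x : Cube n, g (Fin.cons (-1) x) ^ 2)) (pos 1) (pos (-1))
    have h4 := sq_sub_sqrt_sum_sq_le univ (fun x : Cube n => g (Fin.cons 1 x))
      (fun x : Cube n => g (Fin.cons (-1) x))
    rw [Real.sq_sqrt (by positivity), Real.sq_sqrt (by positivity)] at h3
    have hm : (cubeMean (fun x : Cube n => w (Fin.cons 1 x)) +
        cubeMean (fun x : Cube n => w (Fin.cons (-1) x))) / 2 = cubeMean w := by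
      simp only [cubeMean]
      rw [sum_cube_succ, pow_succ]
      field_simp
    rw [hm] at h3
    rw [sum_cube_succ, sum_cube_succ, dirichlet_succ]
    linarith

lemma abs_clamp_sub_clamp_le (y z : ℝ) : |min 1 (max 0 y) - min 1 (max 0 z)| ≤ |y - z| := by
  calc _ ≤ max |(1 : ℝ) - 1| |max 0 y - max 0 z| := abs_min_sub_min_le_max _ _ _ _
    _ ≤ |y - z| := by
        have := abs_max_sub_max_le_max 0 y 0 z
        simp at this ⊢
        simpa using this

/-- The rate of decay of the tail of a Rademacher sum. -/
lemma prob_linForm_gt_add_mul_log_le {n : ℕ} (a : Fin n → ℝ) (ha : ∑ i, a i ^ 2 = 1) (s : ℝ)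
    {δ : ℝ} (hδ : 0 < δ) (hp : 0 < prob fun x => s < linForm a x)
    (hp2 : (prob fun x => s < linForm a x) ≤ 1 / 2) :
    (prob fun x => s + δ < linForm a x) * Real.log (1 / prob fun x => s < linForm a x)
      ≤ 16 / δ ^ 2 * prob fun x => s < linForm a x := by
  classical
  set p := prob fun x => s < linForm a x with hpdef
  set g : Cube n → ℝ := fun x => min 1 (max 0 ((linForm a x - s) / δ)) with hg
  -- The weight is 1 where g can be nonzero, so the left side of the inequality vanishes. The value
  -- p / 4 elsewhere keeps log w defined and the mean of w at most 5p/4, which is below √p.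
  set w : Cube n → ℝ := fun x => if s < linForm a x then 1 else p / 4 with hw
  set I : Cube n → ℝ := fun x => if s < linForm a x then 1 else 0 with hI
  have g0 : ∀ x, ¬ s < linForm a x → g x = 0 := fun x hx => by
    have : (linForm a x - s) / δ ≤ 0 := div_nonpos_of_nonpos_of_nonneg (by linarith) hδ.le
    simp [hg, this]
  have hLS := sum_sq_mul_log_le g w fun x => by
    simp only [hw]; split_ifs <;> linarith
  have h0 : ∑ x, g x ^ 2 * Real.log (w x) = 0 := sum_eq_zero fun x _ => by
    by_cases hx : s < linForm a x
    · simp [hw, hx]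
    · simp [g0 x hx]
  rw [h0] at hLS
  have hmean : cubeMean w ≤ 5 / 4 * p := by
    calc cubeMean w ≤ cubeMean fun x => I x + p / 4 := by
          refine cubeMean_mono fun x => ?_
          simp only [hw, hI]; split_ifs <;> linarith
      _ = 5 / 4 * p := by
          rw [cubeMean_add, cubeMean_const, hpdef, prob_eq_cubeMean]; ring
  have hmpos : 0 < cubeMean w := by
    refine div_pos (sum_pos (fun x _ => ?_) univ_nonempty) (by positivity)
    simp only [hw]; split_ifs <;> linarith
  have hlog : Real.log (cubeMean w) ≤ -(1 / 2 * Real.log (1 / p)) := by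
    have h1 : Real.log (cubeMean w) ≤ Real.log (5 / 4 * p) := Real.log_le_log hmpos hmean
    have h2 : Real.log ((5 / 4) ^ 2 * p) ≤ 0 := Real.log_nonpos (by positivity) (by nlinarith)
    rw [Real.log_mul (by norm_num) hp.ne'] at h1 h2
    rw [Real.log_pow] at h2
    rw [one_div p, Real.log_inv]
    push_cast at h2
    linarith
  have hE : dirichlet g ≤ 8 / δ ^ 2 * ∑ x, I x := by
    have hpt : ∀ x i, (g x - g (flipCoord i x)) ^ 2
        ≤ 4 / δ ^ 2 * a i ^ 2 * (I x + I (flipCoord i x)) := by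
      intro x i
      -- An edge contributes only if one of its ends lies in the halfspace; this is what puts the
      -- factor p on the right.
      by_cases hx : ¬ s < linForm a x ∧ ¬ s < linForm a (flipCoord i x)
      · simp [g0 _ hx.1, g0 _ hx.2, hI, hx.1, hx.2]
      · have h1 : 1 ≤ I x + I (flipCoord i x) := by
          simp only [hI]
          split_ifs with h h' h'
          · norm_num
          · norm_num
          · norm_num
          · exact absurd ⟨h, h'⟩ hx
        have h2 : (g x - g (flipCoord i x)) ^ 2 ≤ 4 / δ ^ 2 * a i ^ 2 := by
          have := abs_clamp_sub_clamp_le ((linForm a x - s) / δ) ((linForm a (flipCoord i x) - s) / δ)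
          refine (sq_le_sq.2 this).trans (le_of_eq ?_)
          rw [linForm_flipCoord, ← sub_div]
          have := unit_cast_sq (x i)
          field_simp
          ring_nf
          rw [this]; ring
        refine h2.trans ?_
        exact le_mul_of_one_le_right (by positivity) h1
    calc dirichlet g ≤ ∑ x, ∑ i, 4 / δ ^ 2 * a i ^ 2 * (I x + I (flipCoord i x)) :=
          sum_le_sum fun x _ => sum_le_sum fun i _ => hpt x i
      _ = ∑ i, 4 / δ ^ 2 * a i ^ 2 * (2 * ∑ x, I x) := by
          rw [sum_comm]
          refine sum_congr rfl fun i _ => ?_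
          rw [← mul_sum, sum_add_distrib]
          have : ∑ x, I (flipCoord i x) = ∑ x, I x := (flipEquiv i).sum_comp I
          rw [this]; ring
      _ = _ := by
          rw [← sum_mul, ← mul_sum, ha]; ring
  have hg2 : ∑ x, (if s + δ < linForm a x then (1 : ℝ) else 0) ≤ ∑ x, g x ^ 2 := by
    refine sum_le_sum fun x _ => ?_
    split_ifs with h
    · have : 1 ≤ (linForm a x - s) / δ := by
        rw [le_div_iff₀ hδ]; linarith
      have : g x = 1 := by
        simp only [hg]
        exact min_eq_left (this.trans (le_max_right _ _))
      simp [this]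
    · positivity
  have hL : 0 ≤ Real.log (1 / p) := Real.log_nonneg (by
    rw [le_div_iff₀ hp]; linarith)
  have hpI : p = (∑ x, I x) / 2 ^ n := by rw [hpdef, prob_eq_cubeMean]; rfl
  rw [prob_eq_cubeMean, cubeMean, div_mul_eq_mul_div]
  nth_rewrite 2 [hpI]
  rw [← mul_div_assoc]
  refine div_le_div_of_nonneg_right ?_ (by positivity)
  have h5 := mul_le_mul_of_nonneg_right hg2 hL
  have h6 := mul_le_mul_of_nonneg_left hlog (show 0 ≤ ∑ x, g x ^ 2 by positivity)
  have h7 : 16 / δ ^ 2 * ∑ x, I x = 2 * (8 / δ ^ 2 * ∑ x, I x) := by ring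
  simp only [hI] at h7 hE
  linarith

/-! ### Reflection principle -/

/-- The part of `linForm b` coming from the coordinates in `G` that precede `j`. -/
def prefixSum {n : ℕ} (b : Fin n → ℝ) (G : Finset (Fin n)) (j : ℕ) (x : Cube n) : ℝ :=
  ∑ i ∈ G with i.val < j, b i * ((x i : ℤ) : ℝ)

/-- Flip the coordinates in `G` that precede `j`. -/
def flipPrefix {n : ℕ} (G : Finset (Fin n)) (j : ℕ) (x : Cube n) : Cube n :=
  fun i => if i ∈ G ∧ i.val < j then -x i else x i

lemma prefixSum_flipPrefix {n : ℕ} (b : Fin n → ℝ) (G : Finset (Fin n)) {j k : ℕ} (h : k ≤ j)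
    (x : Cube n) : prefixSum b G k (flipPrefix G j x) = -prefixSum b G k x := by
  unfold prefixSum
  rw [← sum_neg_distrib]
  refine sum_congr rfl fun i hi => ?_
  rw [mem_filter] at hi
  simp [flipPrefix, hi.1, hi.2.trans_le h]

lemma linForm_flipPrefix {n : ℕ} (b : Fin n → ℝ) (G : Finset (Fin n)) (j : ℕ) (x : Cube n) :
    linForm b (flipPrefix G j x) = linForm b x - 2 * prefixSum b G j x := by
  have h : G.filter (fun i => i.val < j) = univ.filter (fun i => i ∈ G ∧ i.val < j) := by
    ext; simp
  unfold prefixSum linForm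
  rw [h, sum_filter, mul_sum, ← sum_sub_distrib]
  refine sum_congr rfl fun i _ => ?_
  by_cases hi : i ∈ G ∧ i.val < j
  · simp [flipPrefix, hi]; ring
  · simp only [flipPrefix, hi, if_false]; ring

lemma flipPrefix_flipPrefix {n : ℕ} (G : Finset (Fin n)) (j : ℕ) (x : Cube n) :
    flipPrefix G j (flipPrefix G j x) = x := by
  funext i
  by_cases hi : i ∈ G ∧ i.val < j <;> simp [flipPrefix, hi]

lemma prefixSum_of_le {n : ℕ} (b : Fin n → ℝ) (G : Finset (Fin n)) {j : ℕ} (h : n ≤ j)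
    (x : Cube n) : prefixSum b G j x = ∑ i ∈ G, b i * ((x i : ℤ) : ℝ) := by
  unfold prefixSum
  rw [filter_true_of_mem fun i _ => i.isLt.trans_le h]

lemma unit_cast_le_one (u : ℤˣ) : ((u : ℤ) : ℝ) ≤ 1 := by
  rcases Int.units_eq_one_or u with rfl | rfl <;> simp

lemma prefixSum_succ_le {n : ℕ} {b : Fin n → ℝ} {G : Finset (Fin n)} {m : ℝ} (hm : 0 ≤ m)
    (hb0 : ∀ i ∈ G, 0 ≤ b i) (hb : ∀ i ∈ G, b i ≤ m) (j : ℕ) (x : Cube n) :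
    prefixSum b G (j + 1) x ≤ prefixSum b G j x + m := by
  unfold prefixSum
  by_cases hj : ∃ k ∈ G, k.val = j
  · obtain ⟨k, hk, rfl⟩ := hj
    have : G.filter (fun i => i.val < k.val + 1) = insert k (G.filter fun i => i.val < k.val) := by
      ext i
      simp only [mem_filter, mem_insert, Order.lt_add_one_iff, le_iff_lt_or_eq, Fin.val_inj]
      constructor
      · rintro ⟨h1, h2 | rfl⟩ <;> simp_all
      · rintro (rfl | h) <;> simp_all
    rw [this, sum_insert (by simp)]
    have := mul_le_of_le_one_right (hb0 k hk) (unit_cast_le_one (x k))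
    have := hb k hk
    linarith
  · have : G.filter (fun i => i.val < j + 1) = G.filter (fun i => i.val < j) := by
      ext i
      simp only [mem_filter, and_congr_right_iff]
      intro hi
      have : i.val ≠ j := fun h => hj ⟨i, hi, h⟩
      omega
    rw [this]
    linarith

/-- The reflection principle: flipping the prefix up to the first passage of a level `r`. -/
lemma prob_interval_le_of_reflection {n : ℕ} {b : Fin n → ℝ} {G : Finset (Fin n)} {m : ℝ}
    (hm : 0 ≤ m) (hb0 : ∀ i ∈ G, 0 ≤ b i) (hb : ∀ i ∈ G, b i ≤ m) {r : ℝ} (hr : 0 ≤ r) (α ℓ : ℝ) :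
    prob (fun x => (α < linForm b x ∧ linForm b x ≤ α + ℓ) ∧ r ≤ ∑ i ∈ G, b i * ((x i : ℤ) : ℝ))
      ≤ prob fun x => α - 2 * r - 2 * m < linForm b x ∧ linForm b x ≤ α - 2 * r + ℓ := by
  classical
  let P : Cube n → Prop := fun x => ∃ j, r ≤ prefixSum b G j x
  let τ : Cube n → ℕ := fun x => if h : P x then Nat.find h else 0
  have hτ : ∀ x, P x → r ≤ prefixSum b G (τ x) x := fun x hx => by
    simp only [τ, hx, dif_pos]; exact Nat.find_spec hx
  have hmin : ∀ x j, P x → r ≤ prefixSum b G j x → τ x ≤ j := fun x j hx hj => by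
    simp only [τ, hx, dif_pos]; exact Nat.find_min' hx hj
  have hP : ∀ x, r ≤ ∑ i ∈ G, b i * ((x i : ℤ) : ℝ) → P x := fun x hx =>
    ⟨n, by rwa [prefixSum_of_le b G le_rfl]⟩
  have hup : ∀ x, P x → prefixSum b G (τ x) x ≤ r + m := fun x hx => by
    rcases Nat.eq_zero_or_pos (τ x) with h | h
    · rw [h]; simp [prefixSum]; positivity
    · obtain ⟨j, hj⟩ := Nat.exists_eq_succ_of_ne_zero h.ne'
      have h1 : prefixSum b G j x < r := by
        by_contra! h2
        have := hmin x j hx h2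
        omega
      have := prefixSum_succ_le hm hb0 hb j x
      rw [hj]
      simp only [Nat.succ_eq_add_one] at *
      linarith
  -- Flipping negates all prefix sums up to the passage time, so the image still determines that
  -- time, and hence the original point.
  have hle : ∀ x y, P x → P y → flipPrefix G (τ x) x = flipPrefix G (τ y) y → τ x ≤ τ y →
      x = y := by
    intro x y hx hy h hxy
    have h1 := prefixSum_flipPrefix b G hxy y
    rw [← h, prefixSum_flipPrefix b G le_rfl x, neg_inj] at h1
    have h2 := hmin y (τ x) hy (h1 ▸ hτ x hx)
    have e : τ x = τ y := le_antisymm hxy h2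
    rw [← flipPrefix_flipPrefix G (τ x) x, h, e, flipPrefix_flipPrefix]
  refine prob_le_of_injOn (fun x => flipPrefix G (τ x) x) (fun x hx => ?_) fun x y hx hy h => ?_
  · have h1 := hτ x (hP x hx.2)
    have h2 := hup x (hP x hx.2)
    rw [linForm_flipPrefix]
    constructor <;> linarith [hx.1.1, hx.1.2]
  · rcases le_total (τ x) (τ y) with h' | h'
    · exact hle x y (hP x hx.2) (hP y hy.2) h h'
    · exact (hle y x (hP y hy.2) (hP x hx.2) h.symm h').symm

/-- Reflection in all coordinates: above α ≥ r the walk has certainly reached r. The overshoot, at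
most m, widens the target by 2m at its lower end. -/
lemma prob_interval_le_shift {n : ℕ} {b : Fin n → ℝ} {m : ℝ}
    (hm : 0 ≤ m) (hb0 : ∀ i, 0 ≤ b i) (hb : ∀ i, b i ≤ m) {r α : ℝ} (hr : 0 ≤ r) (hrα : r ≤ α)
    (ℓ : ℝ) :
    prob (fun x => α < linForm b x ∧ linForm b x ≤ α + ℓ)
      ≤ prob fun x => α - 2 * r - 2 * m < linForm b x ∧ linForm b x ≤ α - 2 * r + ℓ := by
  refine le_trans (prob_mono fun x hx => ?_)
    (prob_interval_le_of_reflection (G := univ) hm (fun i _ => hb0 i) (fun i _ => hb i) hr α ℓ)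
  exact ⟨hx, hrα.trans hx.1.le⟩

/-! ### Comparison of windows -/

/-- The number of coordinates in `H` where `x` equals `u`. -/
def countEq {n : ℕ} (H : Finset (Fin n)) (u : ℤˣ) (x : Cube n) : ℕ := #{i ∈ H | x i = u}

lemma countEq_flipCoord {n : ℕ} {H : Finset (Fin n)} {i : Fin n} (hi : i ∈ H) {x : Cube n}
    (hx : x i = 1) : countEq H (-1) (flipCoord i x) = countEq H (-1) x + 1 := by
  unfold countEq
  rw [← card_insert_of_notMem (a := i) (by simp [hx])]
  congr 1
  ext k
  rw [mem_insert, mem_filter, mem_filter]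
  by_cases hk : k = i
  · subst hk; simp [flipCoord, hx, hi]
  · simp [flipCoord, hk]

/-- Comparison of neighbouring windows by flipping a single large coordinate. -/
lemma prob_window_le_of_large_coords {n : ℕ} {b : Fin n → ℝ} {a : ℝ} (ha : 0 < a)
    (hb : ∀ i, b i ≤ a) (t : ℝ) :
    prob (fun x => (t + a < linForm b x ∧ linForm b x ≤ t + 2 * a) ∧
        0 < ∑ i with a / 2 < b i, b i * ((x i : ℤ) : ℝ))
      ≤ 2 * prob fun x => t - a < linForm b x ∧ linForm b x ≤ t + a := by
  classical
  set H : Finset (Fin n) := univ.filter fun i => a / 2 < b i with hH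
  set A : Cube n → Prop := fun x => (t + a < linForm b x ∧ linForm b x ≤ t + 2 * a) ∧
        0 < ∑ i ∈ H, b i * ((x i : ℤ) : ℝ) with hA
  set B : Cube n → Prop := fun x => t - a < linForm b x ∧ linForm b x ≤ t + a with hB
  -- A positive sum over weights in (a/2, a] forces fewer than twice as many minus signs as plus
  -- signs.
  have hcount : ∀ x, A x → (countEq H (-1) x : ℝ) + 1 ≤ 2 * countEq H 1 x := by
    intro x hx
    have h1 : ∑ i ∈ H, b i * ((x i : ℤ) : ℝ)
        ≤ ∑ i ∈ H, ((if x i = 1 then a else 0) - if x i = -1 then a / 2 else 0) := by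
      refine sum_le_sum fun i hi => ?_
      have hi' : a / 2 < b i := by simpa [hH] using hi
      have := hb i
      rcases Int.units_eq_one_or (x i) with h | h
      · simp [h]; exact hb i
      · simp [h]; linarith
    rw [sum_sub_distrib, ← sum_filter, ← sum_filter, sum_const, sum_const] at h1
    have h2 := hx.2.trans_le h1
    simp only [nsmul_eq_mul] at h2
    change 0 < (countEq H 1 x : ℝ) * a - (countEq H (-1) x : ℝ) * (a / 2) at h2
    have h3 : (countEq H (-1) x : ℝ) < 2 * countEq H 1 x := by
      by_contra! h
      nlinarith
    exact_mod_cast (show countEq H (-1) x + 1 ≤ 2 * countEq H 1 x by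
      have : countEq H (-1) x < 2 * countEq H 1 x := by exact_mod_cast h3
      omega)
  -- Mass transport: x splits its unit mass equally among the flips of its large positive
  -- coordinates. Each such flip lowers the sum by between a and 2a, and no target receives more
  -- than 2.
  set F : Fin n → Cube n → ℝ := fun i x =>
    if A x ∧ i ∈ H ∧ x i = 1 then 1 / (countEq H 1 x : ℝ) else 0 with hF
  have h1 : ∀ x, (if A x then (1 : ℝ) else 0) = ∑ i, F i x := by
    intro x
    by_cases hx : A x
    · have hpos : (0 : ℝ) < countEq H 1 x := by
        have := hcount x hx
        have h0 : (0 : ℝ) ≤ countEq H (-1) x := by positivity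
        linarith
      simp only [hF, hx, true_and, if_true]
      rw [← sum_filter, sum_const, nsmul_eq_mul]
      have : (univ.filter fun i => i ∈ H ∧ x i = 1) = H.filter fun i => x i = 1 := by
        ext; simp
      rw [this]
      change 1 = (countEq H 1 x : ℝ) * (1 / (countEq H 1 x : ℝ))
      field_simp
    · simp [hF, hx]
  have h2 : ∀ i y, F i (flipCoord i y)
      ≤ if B y ∧ i ∈ H ∧ y i = -1 then 2 / (countEq H (-1) y : ℝ) else 0 := by
    intro i y
    by_cases h : A (flipCoord i y) ∧ i ∈ H ∧ flipCoord i y i = 1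
    · have hy : y i = -1 := by
        have := h.2.2
        simp only [flipCoord, Function.update_self] at this
        rw [← this, neg_neg]
      have hlin := linForm_flipCoord b i y
      have hi : a / 2 < b i := by simpa [hH] using h.2.1
      have hbi := hb i
      have hBy : B y := by
        have := h.1.1
        rw [hlin, hy] at this
        simp only [Units.val_neg, Units.val_one, Int.cast_neg, Int.cast_one] at this
        constructor <;> linarith [this.1, this.2]
      have hc := hcount _ h.1
      have hc2 := countEq_flipCoord h.2.1 h.2.2
      rw [flipCoord_flipCoord] at hc2
      have hc3 : (countEq H (-1) y : ℝ) = countEq H (-1) (flipCoord i y) + 1 := by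
        rw [hc2]; push_cast; ring
      simp only [hF, h, hBy, hy, and_self, if_true]
      rw [← hc3] at hc
      have hp : (0 : ℝ) < countEq H (-1) y := by rw [hc3]; positivity
      rw [div_le_div_iff₀ (by linarith) hp]
      linarith
    · simp only [hF, h, if_false]
      split_ifs <;> positivity
  have h3 : ∀ y, ∑ i, (if B y ∧ i ∈ H ∧ y i = -1 then 2 / (countEq H (-1) y : ℝ) else 0)
      ≤ 2 * if B y then 1 else 0 := by
    intro y
    by_cases hy : B y
    · simp only [hy, true_and, if_true]
      rw [← sum_filter, sum_const, nsmul_eq_mul]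
      have : (univ.filter fun i => i ∈ H ∧ y i = -1) = H.filter fun i => y i = -1 := by
        ext; simp
      rw [this]
      change (countEq H (-1) y : ℝ) * (2 / (countEq H (-1) y : ℝ)) ≤ _
      rcases Nat.eq_zero_or_pos (countEq H (-1) y) with h | h
      · simp [h]
      · have : (0 : ℝ) < countEq H (-1) y := by exact_mod_cast h
        field_simp
        exact le_rfl
    · simp [hy]
  rw [prob_eq_cubeMean, prob_eq_cubeMean, ← cubeMean_mul_left]
  unfold cubeMean
  refine div_le_div_of_nonneg_right ?_ (by positivity)
  have h4 : ∑ x, (if A x then (1 : ℝ) else 0) ≤ ∑ y, 2 * (if B y then (1 : ℝ) else 0) := by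
    calc ∑ x, (if A x then (1 : ℝ) else 0) = ∑ x, ∑ i, F i x := sum_congr rfl fun x _ => h1 x
      _ = ∑ i, ∑ y, F i (flipCoord i y) := by
          rw [sum_comm]
          exact sum_congr rfl fun i _ => ((flipEquiv i).sum_comp (F i)).symm
      _ ≤ ∑ i, ∑ y, if B y ∧ i ∈ H ∧ y i = -1 then 2 / (countEq H (-1) y : ℝ) else 0 :=
          sum_le_sum fun i _ => sum_le_sum fun y _ => h2 i y
      _ = ∑ y, ∑ i, if B y ∧ i ∈ H ∧ y i = -1 then 2 / (countEq H (-1) y : ℝ) else 0 := sum_comm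
      _ ≤ _ := sum_le_sum fun y _ => h3 y
  exact h4

/-- Either the large coordinates have a positive sum and one flip suffices (factor 2), or the small
ones sum to at least a/2 and are reflected at that level (factor 1). Their weights being at most a/2
makes the reflection land exactly in the central window. -/
lemma prob_next_half_window_le {n : ℕ} {b : Fin n → ℝ} {a : ℝ} (ha : 0 < a)
    (hb0 : ∀ i, 0 ≤ b i) (hb : ∀ i, b i ≤ a) {t : ℝ} (ht : 0 ≤ t) :
    prob (fun x => t + a < linForm b x ∧ linForm b x ≤ t + 2 * a)
      ≤ 3 * prob fun x => t - a < linForm b x ∧ linForm b x ≤ t + a := by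
  classical
  have h1 := prob_window_le_of_large_coords ha hb t
  have h2 := prob_interval_le_of_reflection (b := b) (G := univ.filter fun i => ¬ a / 2 < b i)
    (m := a / 2) (by positivity) (fun i _ => hb0 i) (fun i hi => by simpa using hi)
    (r := a / 2) (by positivity) (t + a) a
  have h3 := prob_le_add (A := fun x => t + a < linForm b x ∧ linForm b x ≤ t + 2 * a)
    (B := fun x => (t + a < linForm b x ∧ linForm b x ≤ t + 2 * a) ∧
        0 < ∑ i with a / 2 < b i, b i * ((x i : ℤ) : ℝ))
    (C := fun x => (t + a < linForm b x ∧ linForm b x ≤ t + a + a) ∧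
      a / 2 ≤ ∑ i with ¬ a / 2 < b i, b i * ((x i : ℤ) : ℝ)) fun x hx => by
    have hs : linForm b x = _ :=
      (sum_filter_add_sum_filter_not univ (fun i => a / 2 < b i) fun i => b i * ((x i : ℤ) : ℝ)).symm
    by_cases h : 0 < ∑ i with a / 2 < b i, b i * ((x i : ℤ) : ℝ)
    · exact Or.inl ⟨hx, h⟩
    · refine Or.inr ⟨⟨hx.1, by linarith [hx.2]⟩, ?_⟩
      have := hx.1
      linarith
  have h4 : (fun x : Cube n => t + a - 2 * (a / 2) - 2 * (a / 2) < linForm b x ∧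
      linForm b x ≤ t + a - 2 * (a / 2) + a)
      = fun x => t - a < linForm b x ∧ linForm b x ≤ t + a := by
    funext x
    congr 2 <;> ring_nf
  rw [h4] at h2
  linarith

/-- Among the windows of length `2 * a`, the one centred at `t ≥ 0` is the heaviest up to a constant,
compared with those farther from the origin. -/
lemma prob_far_window_le {n : ℕ} {b : Fin n → ℝ} {a : ℝ} (ha : 0 < a)
    (hb0 : ∀ i, 0 ≤ b i) (hb : ∀ i, b i ≤ a) {t : ℝ} (ht : 0 ≤ t) (k : ℕ) :
    prob (fun x => t + (2 * k - 1) * a < linForm b x ∧ linForm b x ≤ t + (2 * k + 1) * a)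
      ≤ 8 * prob fun x => t - a < linForm b x ∧ linForm b x ≤ t + a := by
  set B := prob fun x => t - a < linForm b x ∧ linForm b x ≤ t + a with hB
  have hB0 : 0 ≤ B := prob_nonneg _
  -- Reflection brings a half window into (t - a, t + 2a], which is the central window and the next
  -- half window: 1 + 3 = 4.
  have half : ∀ α, t + a ≤ α → prob (fun x => α < linForm b x ∧ linForm b x ≤ α + a) ≤ 4 * B := by
    intro α hα
    have h1 := prob_interval_le_shift ha.le hb0 hb (r := (α - t - a) / 2) (α := α)
      (by linarith) (by linarith) a
    have h2 := prob_next_half_window_le ha hb0 hb ht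
    have h3 := prob_le_add (A := fun x => α - 2 * ((α - t - a) / 2) - 2 * a < linForm b x ∧
      linForm b x ≤ α - 2 * ((α - t - a) / 2) + a)
      (B := fun x => t - a < linForm b x ∧ linForm b x ≤ t + a)
      (C := fun x => t + a < linForm b x ∧ linForm b x ≤ t + 2 * a) fun x hx => by
      rcases le_or_gt (linForm b x) (t + a) with h | h
      · exact Or.inl ⟨by linarith [hx.1], h⟩
      · exact Or.inr ⟨h, by linarith [hx.2]⟩
    linarith
  rcases Nat.eq_zero_or_pos k with rfl | hk
  · have : (fun x : Cube n => t + (2 * ((0 : ℕ) : ℝ) - 1) * a < linForm b x ∧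
        linForm b x ≤ t + (2 * ((0 : ℕ) : ℝ) + 1) * a)
        = fun x => t - a < linForm b x ∧ linForm b x ≤ t + a := by
      funext x
      push_cast
      congr 2 <;> ring_nf
    rw [this, ← hB]
    linarith
  · have hk1 : (1 : ℝ) ≤ k := by exact_mod_cast hk
    have h1 := half (t + (2 * k - 1) * a) (by nlinarith)
    have h2 := half (t + 2 * k * a) (by nlinarith)
    have h3 := prob_le_add (A := fun x => t + (2 * k - 1) * a < linForm b x ∧
        linForm b x ≤ t + (2 * k + 1) * a)
      (B := fun x => t + (2 * k - 1) * a < linForm b x ∧ linForm b x ≤ t + (2 * k - 1) * a + a)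
      (C := fun x => t + 2 * k * a < linForm b x ∧ linForm b x ≤ t + 2 * k * a + a) fun x hx => by
      rcases le_or_gt (linForm b x) (t + 2 * k * a) with h | h
      · exact Or.inl ⟨hx.1, by linarith⟩
      · exact Or.inr ⟨h, by linarith [hx.2]⟩
    linarith

/-! ### Pushing mass upward -/

/-- Transition probabilities of a single coordinate: `-1` moves up to `1` with probability `q`. -/
def pushUp (q : ℝ) (u v : ℤˣ) : ℝ :=
  if u = 1 then (if v = 1 then 1 else 0) else (if v = 1 then q else 1 - q)

/-- The kernel that pushes the coordinates up independently, with probabilities `q`. -/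
def pushUpKernel {n : ℕ} (q : Fin n → ℝ) (x y : Cube n) : ℝ := ∏ i, pushUp (q i) (x i) (y i)

lemma pushUpKernel_nonneg {n : ℕ} {q : Fin n → ℝ} (h0 : ∀ i, 0 ≤ q i) (h1 : ∀ i, q i ≤ 1)
    (x y : Cube n) : 0 ≤ pushUpKernel q x y := by
  refine prod_nonneg fun i _ => ?_
  have := h0 i
  have := h1 i
  unfold pushUp
  split_ifs <;> linarith

/-- The column sums factor as ∏ (1 + q_i y_i), so the pushed density is at most exponential in a
linear form. -/
lemma sum_pushUpKernel_le {n : ℕ} {q : Fin n → ℝ} (h0 : ∀ i, 0 ≤ q i) (h1 : ∀ i, q i ≤ 1)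
    (y : Cube n) : ∑ x, pushUpKernel q x y ≤ Real.exp (linForm q y) := by
  unfold pushUpKernel
  rw [sum_cube_prod fun i u => pushUp (q i) u (y i), linForm, Real.exp_sum]
  refine prod_le_prod (fun i _ => ?_) fun i _ => ?_
  · have e0 := h0 i
    have e1 := h1 i
    have : (-1 : ℤˣ) ≠ 1 := by decide
    rcases Int.units_eq_one_or (y i) with h | h <;> simp only [pushUp, h, this, if_true, if_false] <;>
      linarith
  · refine le_trans (le_of_eq ?_) (Real.add_one_le_exp _)
    have : (-1 : ℤˣ) ≠ 1 := by decide
    rcases Int.units_eq_one_or (y i) with h | h <;> simp [pushUp, h, this] <;> ring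

/-- The Laplace transform of the upward displacement, which is a sum of independent jumps 2a_i over
the coordinates at -1. -/
lemma sum_pushUpKernel_mul_exp {n : ℕ} (q a : Fin n → ℝ) (c : ℝ) (x : Cube n) :
    ∑ y, pushUpKernel q x y * Real.exp (-c * (linForm a y - linForm a x))
      = ∏ i, (1 - if x i = 1 then 0 else q i * (1 - Real.exp (-(2 * c * a i)))) := by
  have h : ∀ y, pushUpKernel q x y * Real.exp (-c * (linForm a y - linForm a x))
      = ∏ i, pushUp (q i) (x i) (y i) *
          Real.exp (-c * (a i * ((y i : ℤ) : ℝ) - a i * ((x i : ℤ) : ℝ))) := fun y => by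
    rw [prod_mul_distrib, ← Real.exp_sum, ← mul_sum, sum_sub_distrib]
    rfl
  simp_rw [h]
  rw [sum_cube_prod fun i v => pushUp (q i) (x i) v *
    Real.exp (-c * (a i * ((v : ℤ) : ℝ) - a i * ((x i : ℤ) : ℝ)))]
  refine prod_congr rfl fun i _ => ?_
  have : (-1 : ℤˣ) ≠ 1 := by decide
  rcases Int.units_eq_one_or (x i) with h | h
  · simp [pushUp, h, this]
  · simp only [pushUp, h, this, if_false, if_true]
    have e : -c * (a i * (((1 : ℤˣ) : ℤ) : ℝ) - a i * (((-1 : ℤˣ) : ℤ) : ℝ)) = -(2 * c * a i) := by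
      push_cast; simp; ring
    rw [e]
    simp
    ring

lemma one_sub_sum_le_prod {ι : Type*} (s : Finset ι) (u : ι → ℝ) (h0 : ∀ i ∈ s, 0 ≤ u i)
    (h1 : ∀ i ∈ s, u i ≤ 1) : 1 - ∑ i ∈ s, u i ≤ ∏ i ∈ s, (1 - u i) := by
  classical
  induction s using Finset.induction_on with
  | empty => simp
  | insert i s hi ih =>
    rw [sum_insert hi, prod_insert hi]
    have h2 := ih (fun j hj => h0 j (mem_insert_of_mem hj)) fun j hj => h1 j (mem_insert_of_mem hj)
    have h3 := h0 i (mem_insert_self _ _)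
    have h4 := h1 i (mem_insert_self _ _)
    have h5 : 0 ≤ ∑ j ∈ s, u j := sum_nonneg fun j hj => h0 j (mem_insert_of_mem hj)
    nlinarith

lemma half_le_one_sub_exp_neg {u : ℝ} (h0 : 0 ≤ u) (h1 : u ≤ 1) : u / 2 ≤ 1 - Real.exp (-u) := by
  have h2 := Real.add_one_le_exp u
  have h3 : Real.exp (-u) ≤ 1 / (1 + u) := by
    rw [Real.exp_neg, one_div]
    exact inv_anti₀ (by linarith) (by linarith)
  have h4 : 1 / (1 + u) ≤ 1 - u / 2 := by
    rw [div_le_iff₀ (by linarith)]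
    nlinarith
  linarith

/-- The squared weight of the coordinates equal to `-1`. -/
def negWeight {n : ℕ} (a : Fin n → ℝ) (x : Cube n) : ℝ := ∑ i, if x i = 1 then 0 else a i ^ 2

lemma linForm_sq_eq {n : ℕ} (a : Fin n → ℝ) (x : Cube n) :
    linForm (fun i => a i ^ 2) x = ∑ i, a i ^ 2 - 2 * negWeight a x := by
  unfold linForm negWeight
  rw [mul_sum, ← sum_sub_distrib]
  refine sum_congr rfl fun i _ => ?_
  have : (-1 : ℤˣ) ≠ 1 := by decide
  rcases Int.units_eq_one_or (x i) with h | h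
  · simp [h]
  · simp [h, this]; ring

/-- Low negative weight means that ∑ a_i² x_i exceeds 1/2. As ∑ a_i⁴ ≤ m², Chernoff's bound applies
with the optimal θ = (1/2)/m². -/
lemma prob_negWeight_lt_le {n : ℕ} {a : Fin n → ℝ} {m : ℝ} (hm : 0 < m) (ha0 : ∀ i, 0 ≤ a i)
    (ham : ∀ i, a i ≤ m) (ha : ∑ i, a i ^ 2 = 1) :
    prob (fun x => negWeight a x < 1 / 4) ≤ Real.exp (-(1 / (8 * m ^ 2))) := by
  have h1 := prob_linForm_gt_le (fun i => a i ^ 2) (1 / 2) (θ := 1 / (2 * m ^ 2)) (by positivity)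
  have h2 : ∑ i, (a i ^ 2) ^ 2 ≤ m ^ 2 := by
    calc ∑ i, (a i ^ 2) ^ 2 ≤ ∑ i, m ^ 2 * a i ^ 2 := by
          refine sum_le_sum fun i _ => ?_
          have : a i ^ 2 ≤ m ^ 2 := pow_le_pow_left₀ (ha0 i) (ham i) 2
          nlinarith [sq_nonneg (a i)]
      _ = m ^ 2 := by rw [← mul_sum, ha, mul_one]
  refine (prob_mono fun x hx => ?_).trans (h1.trans ?_)
  · rw [linForm_sq_eq, ha]
    linarith
  · rw [Real.exp_le_exp]
    have h3 : (1 / (2 * m ^ 2)) ^ 2 / 2 * ∑ i, (a i ^ 2) ^ 2 ≤ (1 / (2 * m ^ 2)) ^ 2 / 2 * m ^ 2 := by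
      gcongr
    have h4 : (1 / (2 * m ^ 2)) ^ 2 / 2 * m ^ 2 = 1 / (8 * m ^ 2) := by field_simp; norm_num
    have h5 : 1 / (2 * m ^ 2) * (1 / 2) = 2 * (1 / (8 * m ^ 2)) := by field_simp; norm_num
    linarith

/-- Most of the mass just below `t` can be pushed above `t`. -/
lemma half_le_sum_pushUpKernel {n : ℕ} {a : Fin n → ℝ} {m η t : ℝ} (hm : 0 < m)
    (ha0 : ∀ i, 0 ≤ a i) (ham : ∀ i, a i ≤ m) (ha : ∑ i, a i ^ 2 = 1) (hη : 32 * m ≤ η)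
    (hη2 : η ^ 2 ≤ 1 / 8) {x : Cube n} (hx : t - η / 8 < linForm a x) (hW : 1 / 4 ≤ negWeight a x) :
    1 / 2 ≤ ∑ y, pushUpKernel (fun i => η * a i) x y *
      (if t < linForm a y then Real.exp (-η * (linForm a y - linForm a x)) else 0) := by
  have hη0 : 0 < η := by linarith
  have hη1 : η ≤ 1 / 2 := by nlinarith
  have hq0 : ∀ i, 0 ≤ η * a i := fun i => mul_nonneg hη0.le (ha0 i)
  have hq1 : ∀ i, η * a i ≤ 1 := fun i => by nlinarith [ha0 i, ham i]
  set θ := 1 / (2 * m) with hθ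
  have hθη : η ≤ θ := by
    rw [hθ, le_div_iff₀ (by positivity)]; nlinarith
  -- The indicator of passing t is replaced by a difference of exponentials: if t is not passed, the
  -- displacement is at most η/8 and, as η ≤ θ, the difference is nonpositive.
  have hpt : ∀ y, Real.exp (-η * (linForm a y - linForm a x))
      - Real.exp (θ * (η / 8)) * Real.exp (-θ * (linForm a y - linForm a x))
      ≤ if t < linForm a y then Real.exp (-η * (linForm a y - linForm a x)) else 0 := by
    intro y
    split_ifs with h
    · have := mul_nonneg (Real.exp_nonneg (θ * (η / 8)))
        (Real.exp_nonneg (-θ * (linForm a y - linForm a x)))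
      linarith
    · rw [← Real.exp_add, sub_nonpos, Real.exp_le_exp]
      have hD : linForm a y - linForm a x ≤ η / 8 := by linarith
      nlinarith
  have h1 : ∑ y, pushUpKernel (fun i => η * a i) x y *
      (Real.exp (-η * (linForm a y - linForm a x))
      - Real.exp (θ * (η / 8)) * Real.exp (-θ * (linForm a y - linForm a x))) ≤ _ :=
    sum_le_sum fun y _ => mul_le_mul_of_nonneg_left (hpt y) (pushUpKernel_nonneg hq0 hq1 x y)
  refine le_trans ?_ h1
  have h2 : ∑ y, pushUpKernel (fun i => η * a i) x y *
      (Real.exp (-η * (linForm a y - linForm a x))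
      - Real.exp (θ * (η / 8)) * Real.exp (-θ * (linForm a y - linForm a x)))
      = (∑ y, pushUpKernel (fun i => η * a i) x y * Real.exp (-η * (linForm a y - linForm a x)))
        - Real.exp (θ * (η / 8)) * ∑ y, pushUpKernel (fun i => η * a i) x y *
          Real.exp (-θ * (linForm a y - linForm a x)) := by
    rw [mul_sum, ← sum_sub_distrib]
    exact sum_congr rfl fun y _ => by ring
  rw [h2, sum_pushUpKernel_mul_exp, sum_pushUpKernel_mul_exp]
  have h3 : 3 / 4 ≤ ∏ i, (1 - if x i = 1 then 0 else η * a i * (1 - Real.exp (-(2 * η * a i)))) := by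
    have hu : ∀ i, 0 ≤ 1 - Real.exp (-(2 * η * a i)) ∧
        1 - Real.exp (-(2 * η * a i)) ≤ 1 ∧ 1 - Real.exp (-(2 * η * a i)) ≤ 2 * η * a i := fun i => by
      have e1 := Real.exp_pos (-(2 * η * a i))
      have e2 := Real.add_one_le_exp (-(2 * η * a i))
      have e3 : Real.exp (-(2 * η * a i)) ≤ 1 := Real.exp_le_one_iff.2 (by nlinarith [hq0 i])
      refine ⟨by linarith, by linarith, by linarith⟩
    refine le_trans ?_ (one_sub_sum_le_prod _ _ (fun i _ => ?_) fun i _ => ?_)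
    · have : ∑ i, (if x i = 1 then 0 else η * a i * (1 - Real.exp (-(2 * η * a i))))
          ≤ ∑ i, 2 * η ^ 2 * a i ^ 2 := by
        refine sum_le_sum fun i _ => ?_
        split_ifs
        · positivity
        · have := mul_le_mul_of_nonneg_left (hu i).2.2 (hq0 i)
          linarith
      rw [← mul_sum, ha] at this
      linarith
    · split_ifs
      · exact le_rfl
      · exact mul_nonneg (hq0 i) (hu i).1
    · split_ifs
      · exact zero_le_one
      · exact mul_le_one₀ (hq1 i) (hu i).1 (hu i).2.1
  have h4 : ∏ i, (1 - if x i = 1 then 0 else η * a i * (1 - Real.exp (-(2 * θ * a i))))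
      ≤ Real.exp (-(η * θ * negWeight a x)) := by
    rw [negWeight, mul_sum, ← sum_neg_distrib, Real.exp_sum]
    refine prod_le_prod (fun i _ => ?_) fun i _ => ?_
    · split_ifs
      · norm_num
      · have e1 := Real.exp_pos (-(2 * θ * a i))
        nlinarith [hq0 i, hq1 i]
    · split_ifs
      · simp
      · have hθa : 2 * θ * a i ≤ 1 := by
          rw [hθ, show 2 * (1 / (2 * m)) * a i = a i / m by field_simp, div_le_one hm]
          exact ham i
        have e1 := half_le_one_sub_exp_neg (mul_nonneg (by positivity) (ha0 i)) hθa
        have e2 := mul_le_mul_of_nonneg_left e1 (hq0 i)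
        have e3 := Real.add_one_le_exp (-(η * θ * a i ^ 2))
        nlinarith
  have h5 : Real.exp (θ * (η / 8)) * Real.exp (-(η * θ * negWeight a x)) ≤ 1 / 4 := by
    rw [← Real.exp_add]
    have hθη2 : 16 ≤ η * θ := by
      rw [hθ, mul_one_div, le_div_iff₀ (by positivity)]; linarith
    have : θ * (η / 8) + -(η * θ * negWeight a x) ≤ -2 := by nlinarith
    refine (Real.exp_le_exp.2 this).trans ?_
    have e : Real.exp (-2) * Real.exp 2 = 1 := by rw [← Real.exp_add]; simp
    have e2 : (1 + 1 : ℝ) * (1 + 1) ≤ Real.exp 2 := by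
      have := Real.add_one_le_exp (1 : ℝ)
      rw [show (2 : ℝ) = 1 + 1 by norm_num, Real.exp_add]
      gcongr
    nlinarith [Real.exp_pos (-2)]
  have h6 := mul_le_mul_of_nonneg_left h4 (Real.exp_nonneg (θ * (η / 8)))
  linarith

/-- Raising each -1 with probability η a_i moves the sum up by at least η/2 on average, enough to
pass t. The factor exp(η (t - S(y))) compensates the column sums of the kernel up to exp(η t) ≤ 2,
while each starting point keeps weight at least 1/2. -/
lemma prob_near_below_le {n : ℕ} {a : Fin n → ℝ} {m η t : ℝ} (hm : 0 < m)
    (ha0 : ∀ i, 0 ≤ a i) (ham : ∀ i, a i ≤ m) (ha : ∑ i, a i ^ 2 = 1) (hη : 32 * m ≤ η)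
    (hη2 : η ^ 2 ≤ 1 / 8) (ht : η * t ≤ 1 / 2) :
    prob (fun x => (t - η / 8 < linForm a x ∧ linForm a x ≤ t) ∧ 1 / 4 ≤ negWeight a x)
      ≤ 4 * prob fun x => t < linForm a x := by
  classical
  have hη0 : 0 < η := by linarith
  have hη1 : η ≤ 1 / 2 := by nlinarith
  have hq0 : ∀ i, 0 ≤ η * a i := fun i => mul_nonneg hη0.le (ha0 i)
  have hq1 : ∀ i, η * a i ≤ 1 := fun i => by nlinarith [ha0 i, ham i]
  set A : Cube n → Prop :=
    fun x => (t - η / 8 < linForm a x ∧ linForm a x ≤ t) ∧ 1 / 4 ≤ negWeight a x with hA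
  set K := pushUpKernel (fun i => η * a i) with hK
  have hK0 : ∀ x y, 0 ≤ K x y := pushUpKernel_nonneg hq0 hq1
  have hexp : Real.exp (η * t) ≤ 2 := by
    refine (Real.exp_le_exp.2 ht).trans ?_
    have e : Real.exp (1 / 2) * Real.exp (1 / 2) = Real.exp 1 := by
      rw [← Real.exp_add]; norm_num
    have := Real.exp_one_lt_d9
    by_contra! h
    nlinarith
  have hlin : ∀ y : Cube n, linForm (fun i => η * a i) y = η * linForm a y := fun y => by
    simp only [linForm, mul_sum, mul_assoc]
  have h1 : ∀ x, (if A x then (1 : ℝ) else 0) ≤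
      2 * ∑ y, K x y * (if t < linForm a y then Real.exp (η * t) * Real.exp (-(η * linForm a y)) else 0) := by
    intro x
    by_cases hx : A x
    · have h2 := half_le_sum_pushUpKernel hm ha0 ham ha hη hη2 hx.1.1 hx.2
      simp only [hx, if_true]
      have h3 : ∑ y, K x y *
          (if t < linForm a y then Real.exp (-η * (linForm a y - linForm a x)) else 0)
          ≤ ∑ y, K x y *
          (if t < linForm a y then Real.exp (η * t) * Real.exp (-(η * linForm a y)) else 0) := by
        refine sum_le_sum fun y _ => mul_le_mul_of_nonneg_left ?_ (hK0 x y)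
        split_ifs
        · rw [← Real.exp_add, Real.exp_le_exp]
          have := hx.1.2
          nlinarith
        · exact le_rfl
      linarith
    · simp only [hx, if_false]
      refine mul_nonneg zero_le_two (sum_nonneg fun y _ => mul_nonneg (hK0 x y) ?_)
      split_ifs <;> positivity
  have h2 : ∀ y, (∑ x, K x y) *
      (if t < linForm a y then Real.exp (η * t) * Real.exp (-(η * linForm a y)) else 0)
      ≤ 2 * if t < linForm a y then 1 else 0 := by
    intro y
    split_ifs
    · have h3 := sum_pushUpKernel_le hq0 hq1 y
      rw [hlin] at h3
      calc _ ≤ Real.exp (η * linForm a y) * (Real.exp (η * t) * Real.exp (-(η * linForm a y))) := by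
            gcongr
        _ = Real.exp (η * t) := by
            rw [mul_left_comm, ← Real.exp_add]; simp
        _ ≤ _ := by linarith
    · simp
  rw [prob_eq_cubeMean, prob_eq_cubeMean, ← cubeMean_mul_left]
  unfold cubeMean
  refine div_le_div_of_nonneg_right ?_ (by positivity)
  beta_reduce
  have h4 : ∑ x, (if A x then (1 : ℝ) else 0) ≤ ∑ y, 4 * if t < linForm a y then (1 : ℝ) else 0 := by
    calc ∑ x, (if A x then (1 : ℝ) else 0)
        ≤ ∑ x, 2 * ∑ y, K x y *
          (if t < linForm a y then Real.exp (η * t) * Real.exp (-(η * linForm a y)) else 0) :=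
          sum_le_sum fun x _ => h1 x
      _ = 2 * ∑ y, (∑ x, K x y) *
          (if t < linForm a y then Real.exp (η * t) * Real.exp (-(η * linForm a y)) else 0) := by
          rw [← mul_sum, sum_comm]
          simp only [sum_mul]
      _ ≤ 2 * ∑ y, (2 * if t < linForm a y then (1 : ℝ) else 0) := by
          exact mul_le_mul_of_nonneg_left (sum_le_sum fun y _ => h2 y) zero_le_two
      _ = _ := by
          rw [mul_sum]
          exact sum_congr rfl fun y _ => by ring
  exact h4

/-- If the weights are small compared to `1 / √log (1 / p)`, the tail does not decay too fast. -/
lemma prob_below_le {n : ℕ} {a : Fin n → ℝ} {m t : ℝ} (hm : 0 < m)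
    (ha0 : ∀ i, 0 ≤ a i) (ham : ∀ i, a i ≤ m) (ha : ∑ i, a i ^ 2 = 1) (ht : 0 ≤ t)
    (hp : 0 < prob fun x => t < linForm a x) (hp2 : (prob fun x => t < linForm a x) ≤ 1 / 2)
    {L : ℝ} (hL0 : 0 < L) (hL : L ^ 2 = Real.log (1 / prob fun x => t < linForm a x))
    (hmL : m * L ≤ 1 / 128) :
    prob (fun x => t - 1 / (32 * L) < linForm a x ∧ linForm a x ≤ t)
      ≤ 5 * prob fun x => t < linForm a x := by
  set p := prob fun x => t < linForm a x with hpdef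
  have hpL : p = Real.exp (-L ^ 2) := by
    rw [hL, one_div, Real.log_inv, neg_neg, Real.exp_log hp]
  have hL2 : 1 / 2 ≤ L ^ 2 := by
    rw [hL]
    have h1 : Real.log 2 ≤ Real.log (1 / p) := Real.log_le_log two_pos (by
      rw [le_div_iff₀ hp]; linarith)
    have := Real.log_two_gt_d9
    linarith
  -- Chernoff's bound with θ = t controls t by L, so that η = 1 / (4 * L) satisfies η t ≤ 1/2.
  have htL : t ^ 2 / 2 ≤ L ^ 2 := by
    have h1 := prob_linForm_gt_le a t ht
    rw [← hpdef, hpL, Real.exp_le_exp, ha] at h1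
    nlinarith
  have hη : 32 * m ≤ 1 / (4 * L) := by
    rw [le_div_iff₀ (by positivity)]; linarith
  have hη2 : (1 / (4 * L)) ^ 2 ≤ 1 / 8 := by
    rw [div_pow, mul_pow, one_pow, div_le_div_iff₀ (by positivity) (by norm_num)]; linarith
  have hηt : 1 / (4 * L) * t ≤ 1 / 2 := by
    rw [div_mul_eq_mul_div, one_mul, div_le_iff₀ (by positivity)]
    nlinarith
  have h1 := prob_near_below_le hm ha0 ham ha hη hη2 hηt
  have h2 := prob_negWeight_lt_le hm ha0 ham ha
  have h3 : Real.exp (-(1 / (8 * m ^ 2))) ≤ p := by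
    rw [hpL, Real.exp_le_exp, neg_le_neg_iff, le_div_iff₀ (by positivity)]
    have := mul_pos hm hL0
    nlinarith
  have h4 := prob_le_add (A := fun x => t - 1 / (32 * L) < linForm a x ∧ linForm a x ≤ t)
    (B := fun x => (t - 1 / (4 * L) / 8 < linForm a x ∧ linForm a x ≤ t) ∧ 1 / 4 ≤ negWeight a x)
    (C := fun x => negWeight a x < 1 / 4) fun x hx => by
      rcases lt_or_ge (negWeight a x) (1 / 4) with h | h
      · exact Or.inr h
      · refine Or.inl ⟨⟨?_, hx.2⟩, h⟩
        have : 1 / (4 * L) / 8 = 1 / (32 * L) := by field_simp; norm_num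
        rw [this]; exact hx.1
  linarith

/-! ### Anticoncentration -/

lemma cubeMean_cos_linForm_sub {n : ℕ} (b : Fin n → ℝ) (φ : ℝ) :
    cubeMean (fun x => Real.cos (linForm b x - φ)) = Real.cos φ * ∏ i, Real.cos (b i) := by
  have h1 : ∑ x : Cube n, Complex.exp ((linForm b x - φ : ℝ) * Complex.I)
      = ((2 ^ n * ∏ i, Real.cos (b i) : ℝ) : ℂ) * Complex.exp ((-φ : ℝ) * Complex.I) := by
    have e : ∀ x : Cube n, Complex.exp ((linForm b x - φ : ℝ) * Complex.I)
        = (∏ i, Complex.exp ((b i * ((x i : ℤ) : ℝ) : ℝ) * Complex.I)) *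
          Complex.exp ((-φ : ℝ) * Complex.I) := fun x => by
      rw [← Complex.exp_sum, ← Complex.exp_add, ← sum_mul, ← add_mul, linForm]
      push_cast
      ring_nf
    simp_rw [e]
    rw [← sum_mul, sum_cube_prod fun i u => Complex.exp ((b i * ((u : ℤ) : ℝ) : ℝ) * Complex.I)]
    congr 1
    have h2 : (2 : ℝ) ^ n = ∏ _i : Fin n, (2 : ℝ) := by simp
    rw [h2, ← prod_mul_distrib]
    push_cast
    refine prod_congr rfl fun i _ => ?_
    rw [Complex.two_cos]
    simp
  have h3 := congrArg Complex.re h1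
  rw [Complex.re_sum, Complex.re_ofReal_mul, Complex.exp_ofReal_mul_I_re, Real.cos_neg] at h3
  simp only [Complex.exp_ofReal_mul_I_re] at h3
  have : (2 : ℝ) ^ n ≠ 0 := by positivity
  rw [cubeMean, h3]
  field_simp

lemma cos_le_exp_neg_sq_div {u : ℝ} (hu : |u| ≤ 1) : Real.cos u ≤ Real.exp (-(u ^ 2 / 4)) := by
  have h1 := abs_le.1 (Real.cos_bound hu)
  have h2 := Real.add_one_le_exp (-(u ^ 2 / 4))
  have h3 : |u| ^ 4 ≤ u ^ 2 := by
    have : u ^ 2 ≤ 1 := (sq_le_one_iff_abs_le_one u).2 hu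
    rw [show |u| ^ 4 = (|u| ^ 2) ^ 2 by ring, sq_abs]
    nlinarith [sq_nonneg u]
  have h4 := sq_nonneg u
  linarith [h1.2]

/-- The product of cosines has Gaussian decay exp(-j²/4) as long as all angles stay in [0, 1]; a
geometric bound is enough for the summation. -/
lemma cubeMean_cos_le {n : ℕ} {a : Fin n → ℝ} {m : ℝ} (ha0 : ∀ i, 0 ≤ a i)
    (ham : ∀ i, a i ≤ m) (ha : ∑ i, a i ^ 2 = 1) {j : ℕ} (hj : j * m ≤ 1) (c : ℝ) :
    cubeMean (fun x => Real.cos (j * (linForm a x - c))) ≤ (4 / 5) ^ j := by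
  have e : ∀ x : Cube n, (j : ℝ) * (linForm a x - c) = linForm (fun i => j * a i) x - j * c := by
    intro x
    simp only [linForm, mul_sub, mul_sum, mul_assoc]
  simp_rw [e]
  rw [cubeMean_cos_linForm_sub]
  have hj0 : (0 : ℝ) ≤ j := by positivity
  have hu : ∀ i, |j * a i| ≤ 1 := fun i => by
    rw [abs_of_nonneg (mul_nonneg hj0 (ha0 i))]
    exact (mul_le_mul_of_nonneg_left (ham i) hj0).trans hj
  have hcos : ∀ i, 0 ≤ Real.cos (j * a i) := fun i => by
    refine Real.cos_nonneg_of_mem_Icc ⟨?_, ?_⟩ <;>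
      linarith [abs_le.1 (hu i), Real.pi_gt_three]
  calc Real.cos (j * c) * ∏ i, Real.cos (j * a i) ≤ ∏ i, Real.cos (j * a i) :=
        mul_le_of_le_one_left (prod_nonneg fun i _ => hcos i) (Real.cos_le_one _)
    _ ≤ ∏ i, Real.exp (-((j * a i) ^ 2 / 4)) :=
        prod_le_prod (fun i _ => hcos i) fun i _ => cos_le_exp_neg_sq_div (hu i)
    _ = Real.exp (-((j : ℝ) ^ 2 / 4)) := by
        rw [← Real.exp_sum]
        congr 1
        rw [sum_neg_distrib, ← sum_div]
        simp only [mul_pow]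
        rw [← mul_sum, ha, mul_one]
    _ ≤ Real.exp (-(1 / 4)) ^ j := by
        rw [← Real.exp_nat_mul, Real.exp_le_exp]
        have : (j : ℝ) ≤ (j : ℝ) ^ 2 := by exact_mod_cast Nat.le_self_pow two_ne_zero j
        linarith
    _ ≤ (4 / 5) ^ j := by
        refine pow_le_pow_left₀ (Real.exp_nonneg _) ?_ j
        rw [Real.exp_neg, inv_le_comm₀ (Real.exp_pos _) (by norm_num)]
        have := Real.add_one_le_exp (1 / 4 : ℝ)
        linarith

lemma sum_range_pow_dist_le (N : ℕ) :
    ∑ k ∈ range N, ∑ l ∈ range N, (4 / 5 : ℝ) ^ ((k - l) + (l - k)) ≤ 9 * N := by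
  have hS : ∀ N : ℕ, ∑ l ∈ range N, (4 / 5 : ℝ) ^ (N - l) ≤ 4 := by
    intro N
    induction N with
    | zero => simp
    | succ N ih =>
      rw [sum_range_succ]
      have : ∑ l ∈ range N, (4 / 5 : ℝ) ^ (N + 1 - l) = 4 / 5 * ∑ l ∈ range N, (4 / 5 : ℝ) ^ (N - l) := by
        rw [mul_sum]
        refine sum_congr rfl fun l hl => ?_
        rw [Nat.succ_sub (mem_range.1 hl).le, pow_succ']
      rw [this]
      simp only [Nat.add_sub_cancel_left, pow_one]
      linarith
  induction N with
  | zero => simp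
  | succ N ih =>
    rw [sum_range_succ, sum_range_succ]
    simp only [sum_range_succ _ N]
    rw [sum_add_distrib]
    have e1 : ∀ l ∈ range N, (4 / 5 : ℝ) ^ (N - l + (l - N)) = (4 / 5) ^ (N - l) := fun l hl => by
      rw [Nat.sub_eq_zero_of_le (mem_range.1 hl).le, add_zero]
    have e2 : ∀ l ∈ range N, (4 / 5 : ℝ) ^ (l - N + (N - l)) = (4 / 5) ^ (N - l) := fun l hl => by
      rw [Nat.sub_eq_zero_of_le (mem_range.1 hl).le, zero_add]
    rw [sum_congr rfl e1, sum_congr rfl e2]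
    have := hS N
    simp only [Nat.sub_self, add_zero, pow_zero]
    push_cast
    linarith

/-- The Fejér kernel as |∑ exp(ikv)|². With truncated subtraction, k - l + (l - k) is |k - l|. -/
lemma sum_sum_cos_eq (N : ℕ) (v : ℝ) :
    ∑ k ∈ range N, ∑ l ∈ range N, Real.cos (((k - l + (l - k) : ℕ) : ℝ) * v)
      = (∑ k ∈ range N, Real.cos (k * v)) ^ 2 + (∑ k ∈ range N, Real.sin (k * v)) ^ 2 := by
  rw [sq, sq, sum_mul_sum, sum_mul_sum, ← sum_add_distrib]
  refine sum_congr rfl fun k _ => ?_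
  rw [← sum_add_distrib]
  refine sum_congr rfl fun l _ => ?_
  rw [← Real.cos_sub]
  rcases le_total k l with h | h
  · rw [Nat.sub_eq_zero_of_le h, zero_add, Nat.cast_sub h, ← Real.cos_neg]
    congr 1; ring
  · rw [Nat.sub_eq_zero_of_le h, add_zero, Nat.cast_sub h]
    congr 1; ring

/-- An anticoncentration inequality of Littlewood–Offord type. -/
lemma prob_abs_linForm_sub_le {n : ℕ} {a : Fin n → ℝ} {m : ℝ} (hm : 0 < m) (ha0 : ∀ i, 0 ≤ a i)
    (ham : ∀ i, a i ≤ m) (ha : ∑ i, a i ^ 2 = 1) (c : ℝ) :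
    prob (fun x => |linForm a x - c| ≤ m) ≤ 72 * m := by
  classical
  rcases lt_or_ge (1 / 2) m with hm2 | hm2
  · exact (prob_le_one _).trans (by linarith)
  -- The largest number of frequencies keeping k m ≤ 1: the kernel is then at least N²/4 on the
  -- window, while its mean is at most 9N.
  set N := ⌊1 / m⌋₊ with hN
  have hN1 : (N : ℝ) ≤ 1 / m := Nat.floor_le (by positivity)
  have hN2 : 1 / m < N + 1 := Nat.lt_floor_add_one _
  have hm3 : 2 ≤ 1 / m := by rw [le_div_iff₀ hm]; linarith
  have hN3 : 1 / m ≤ 2 * N := by linarith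
  have hN0 : (0 : ℝ) < N := by linarith
  have hNm : N * m ≤ 1 := by rwa [le_div_iff₀ hm] at hN1
  have hsmall : ∀ k ∈ range N, (k : ℝ) * m ≤ 1 := fun k hk => by
    have : (k : ℝ) ≤ N := by exact_mod_cast (mem_range.1 hk).le
    nlinarith
  have hpt : ∀ x, (N : ℝ) ^ 2 / 4 * (if |linForm a x - c| ≤ m then 1 else 0) ≤
      ∑ k ∈ range N, ∑ l ∈ range N, Real.cos (((k - l + (l - k) : ℕ) : ℝ) * (linForm a x - c)) := by
    intro x
    rw [sum_sum_cos_eq]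
    split_ifs with h
    · have hc : (N : ℝ) / 2 ≤ ∑ k ∈ range N, Real.cos (k * (linForm a x - c)) := by
        have : ∑ _k ∈ range N, (1 / 2 : ℝ) ≤ ∑ k ∈ range N, Real.cos (k * (linForm a x - c)) := by
          refine sum_le_sum fun k hk => ?_
          have h1 : |k * (linForm a x - c)| ≤ 1 := by
            rw [abs_mul, Nat.abs_cast]
            exact (mul_le_mul_of_nonneg_left h (by positivity)).trans (hsmall k hk)
          have h2 : (k * (linForm a x - c)) ^ 2 ≤ 1 := (sq_le_one_iff_abs_le_one _).2 h1
          have := Real.one_sub_sq_div_two_le_cos (x := k * (linForm a x - c))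
          linarith
        rw [sum_const, card_range, nsmul_eq_mul] at this
        linarith
      have := sq_nonneg (∑ k ∈ range N, Real.sin (k * (linForm a x - c)))
      nlinarith
    · rw [mul_zero]; positivity
  have h1 := cubeMean_mono hpt
  rw [cubeMean_mul_left, ← prob_eq_cubeMean] at h1
  have h2 : cubeMean (fun x => ∑ k ∈ range N, ∑ l ∈ range N,
      Real.cos (((k - l + (l - k) : ℕ) : ℝ) * (linForm a x - c)))
      = ∑ k ∈ range N, ∑ l ∈ range N,
        cubeMean fun x => Real.cos (((k - l + (l - k) : ℕ) : ℝ) * (linForm a x - c)) := by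
    unfold cubeMean
    rw [sum_comm, sum_div]
    refine sum_congr rfl fun k _ => ?_
    rw [sum_comm, sum_div]
  rw [h2] at h1
  have h3 : ∑ k ∈ range N, ∑ l ∈ range N,
      cubeMean (fun x => Real.cos (((k - l + (l - k) : ℕ) : ℝ) * (linForm a x - c))) ≤ 9 * N := by
    refine le_trans (sum_le_sum fun k hk => sum_le_sum fun l hl => ?_) (sum_range_pow_dist_le N)
    refine cubeMean_cos_le ha0 ham ha ?_ c
    refine hsmall _ (mem_range.2 ?_)
    have := mem_range.1 hk
    have := mem_range.1 hl
    omega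
  have h4 : (prob fun x => |linForm a x - c| ≤ m) * N ≤ 36 := by
    have := h1.trans h3
    have : (N : ℝ) * ((prob fun x => |linForm a x - c| ≤ m) * N) ≤ N * 36 := by linarith
    exact le_of_mul_le_mul_left this hN0
  have h5 : 1 ≤ 2 * N * m := by rwa [div_le_iff₀ hm] at hN3
  have h6 := prob_nonneg fun x => |linForm a x - c| ≤ m
  set P := prob fun x => |linForm a x - c| ≤ m
  calc P ≤ P * (2 * N * m) := le_mul_of_one_le_right h6 h5
    _ = 2 * m * (P * N) := by ring
    _ ≤ 2 * m * 36 := by gcongr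
    _ = _ := by ring

/-! ### Influences of halfspaces -/

lemma cubeMean_halfspace {n : ℕ} (a : Fin n → ℝ) (t : ℝ) :
    cubeMean (halfspace a t) = prob fun x => t < linForm a x := by
  rw [prob_eq_cubeMean]
  rfl

lemma halfspace_eq {n : ℕ} (a : Fin n → ℝ) (t : ℝ) (x : Cube n) :
    halfspace a t x = if t < linForm a x then 1 else 0 := rfl

lemma influence_nonneg {n : ℕ} (f : Cube n → ℝ) (k : Fin n) : 0 ≤ influence f k := by
  rw [influence, cubeProb_eq_prob]
  exact prob_nonneg _

/-- On a pivotal edge the upper end lies in (t, t + 2a_i]; the factor 2 accounts for which end x is.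
-/
lemma influence_halfspace_le {n : ℕ} {a : Fin n → ℝ} {i : Fin n} (hi : 0 ≤ a i) (t : ℝ) :
    influence (halfspace a t) i
      ≤ 2 * prob fun x => t < linForm a x ∧ linForm a x ≤ t + 2 * a i := by
  rw [influence, cubeProb_eq_prob]
  have h1 : prob (fun x => t < linForm a (flipCoord i x) ∧ linForm a (flipCoord i x) ≤ t + 2 * a i)
      ≤ prob fun x => t < linForm a x ∧ linForm a x ≤ t + 2 * a i :=
    prob_le_of_injOn (flipCoord i) (fun x hx => hx) fun x y _ _ h => (flipEquiv i).injective h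
  refine (prob_le_add (B := fun x => t < linForm a x ∧ linForm a x ≤ t + 2 * a i)
    (C := fun x => t < linForm a (flipCoord i x) ∧ linForm a (flipCoord i x) ≤ t + 2 * a i)
    fun x hx => ?_).trans (by linarith)
  have h2 := mul_le_of_le_one_right hi (unit_cast_le_one (x i))
  have h3 := mul_le_of_le_one_right hi (unit_cast_le_one (-x i))
  have h4 := linForm_flipCoord a i x
  push_cast at h3
  rw [halfspace_eq, halfspace_eq] at hx
  by_cases h5 : t < linForm a x <;> by_cases h6 : t < linForm a (flipCoord i x)
  · simp [h5, h6] at hx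
  · left; constructor <;> linarith
  · right; constructor <;> linarith
  · simp [h5, h6] at hx

lemma linForm_update_zero {n : ℕ} (a : Fin n → ℝ) (k : Fin n) (x : Cube n) :
    linForm (Function.update a k 0) x = linForm a x - a k * ((x k : ℤ) : ℝ) := by
  unfold linForm
  rw [← add_sum_erase _ _ (mem_univ k),
    ← add_sum_erase univ (fun i => a i * ((x i : ℤ) : ℝ)) (mem_univ k)]
  have : ∀ i ∈ univ.erase k, Function.update a k 0 i * ((x i : ℤ) : ℝ) = a i * ((x i : ℤ) : ℝ) :=
    fun i hi => by rw [Function.update_of_ne (ne_of_mem_erase hi)]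
  rw [sum_congr rfl this]
  simp

/-- If the other coordinates sum to within a_k of t, the sign of the kth one decides. -/
lemma prob_window_le_influence {n : ℕ} {a : Fin n → ℝ} {k : Fin n} (t : ℝ) :
    (prob fun x => t - a k < linForm (Function.update a k 0) x ∧
      linForm (Function.update a k 0) x ≤ t + a k) ≤ influence (halfspace a t) k := by
  rw [influence, cubeProb_eq_prob]
  refine prob_mono fun x hx => ?_
  rw [linForm_update_zero] at hx
  rw [halfspace_eq, halfspace_eq, linForm_flipCoord]
  rcases Int.units_eq_one_or (x k) with h | h
  · rw [h] at hx ⊢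
    simp only [Units.val_one, Int.cast_one, mul_one] at hx ⊢
    rw [if_pos (by linarith [hx.1]), if_neg (by linarith [hx.2])]
    norm_num
  · rw [h] at hx ⊢
    simp only [Units.val_neg, Units.val_one, Int.cast_neg, Int.cast_one, mul_neg, mul_one] at hx ⊢
    rw [if_neg (by linarith [hx.2]), if_pos (by linarith [hx.1])]
    norm_num

lemma prob_add_prob_le {n : ℕ} {A B C : Cube n → Prop} (hA : ∀ x, A x → C x) (hB : ∀ x, B x → C x)
    (hd : ∀ x, A x → ¬ B x) : prob A + prob B ≤ prob C := by
  classical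
  rw [prob_eq_cubeMean, prob_eq_cubeMean, prob_eq_cubeMean, ← cubeMean_add]
  refine cubeMean_mono fun x => ?_
  by_cases h1 : A x
  · simp [h1, hd x h1, hA x h1]
  · by_cases h2 : B x
    · simp [h1, h2, hB x h2]
    · by_cases h3 : C x <;> simp [h1, h2, h3]

lemma prob_pos {n : ℕ} {A : Cube n → Prop} {x : Cube n} (hx : A x) : 0 < prob A := by
  classical
  unfold prob cubeProb
  refine div_pos (Nat.cast_pos.2 (card_pos.2 ⟨x, ?_⟩)) (by positivity)
  simpa using hx

lemma prob_comp_neg_le {n : ℕ} (A : Cube n → Prop) : prob (fun x => A (-x)) ≤ prob A :=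
  prob_le_of_injOn (fun x => -x) (fun _ hx => hx) fun _ _ _ _ h => neg_injective h

/-- A halfspace of measure at most `1 / 2` may be assumed to have a nonnegative threshold. -/
lemma halfspace_eq_halfspace_zero {n : ℕ} {a : Fin n → ℝ} {t : ℝ} (ht : t < 0)
    (hp : cubeMean (halfspace a t) ≤ 1 / 2) : halfspace a t = halfspace a 0 := by
  rw [cubeMean_halfspace] at hp
  have h1 := prob_le_add (A := fun _ : Cube n => True) (B := fun x => 0 ≤ linForm a x)
    (C := fun x => 0 < linForm a (-x)) fun x _ => by
      rw [linForm_neg]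
      rcases le_or_gt 0 (linForm a x) with h | h
      · exact Or.inl h
      · exact Or.inr (by linarith)
  have h2 := prob_comp_neg_le fun x => 0 < linForm a x
  have h3 : (prob fun x => 0 ≤ linForm a x) ≤ prob fun x => t < linForm a x :=
    prob_mono fun x hx => by linarith
  have h4 := prob_add_prob_le (A := fun x => 0 < linForm a x)
    (B := fun x => t < linForm a x ∧ linForm a x ≤ 0) (C := fun x => t < linForm a x)
    (fun x hx => by linarith) (fun x hx => hx.1) fun x hx => by
      rintro ⟨_, h⟩; linarith
  rw [prob_true] at h1
  funext x
  rw [halfspace_eq, halfspace_eq]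
  by_cases h5 : t < linForm a x
  · by_cases h6 : 0 < linForm a x
    · simp [h5, h6]
    · have := prob_pos (A := fun x => t < linForm a x ∧ linForm a x ≤ 0) (x := x)
        ⟨h5, not_lt.1 h6⟩
      linarith
  · have h6 : ¬ 0 < linForm a x := by linarith
    simp [h5, h6]

/-! ### The two bounds -/

section Bounds

variable {n : ℕ} {a : Fin n → ℝ} {t L : ℝ} {k : Fin n}

lemma prob_window_le_sixteen_mul_influence (ha0 : ∀ i, 0 ≤ a i) (hk : ∀ i, a i ≤ a k)
    (hpos : 0 < a k) (ht : 0 ≤ t) (j : ℕ) :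
    prob (fun x => t + 2 * j * a k < linForm a x ∧ linForm a x ≤ t + 2 * (j + 1) * a k)
      ≤ 16 * influence (halfspace a t) k := by
  set b := Function.update a k 0 with hb
  have hb0 : ∀ i, 0 ≤ b i := fun i => by
    rcases eq_or_ne i k with rfl | h
    · simp [hb]
    · simpa [hb, h] using ha0 i
  have hbk : ∀ i, b i ≤ a k := fun i => by
    rcases eq_or_ne i k with rfl | h
    · simpa [hb] using hpos.le
    · simpa [hb, h] using hk i
  have h1 := prob_far_window_le hpos hb0 hbk ht j
  have h2 := prob_far_window_le hpos hb0 hbk ht (j + 1)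
  have h3 := prob_window_le_influence (a := a) (k := k) t
  -- The value of x k decides which of two adjacent windows of the reduced sum is hit: 8 + 8 = 16.
  have h4 := prob_le_add
    (A := fun x => t + 2 * j * a k < linForm a x ∧ linForm a x ≤ t + 2 * (j + 1) * a k)
    (B := fun x => t + (2 * j - 1) * a k < linForm b x ∧ linForm b x ≤ t + (2 * j + 1) * a k)
    (C := fun x => t + (2 * (j + 1 : ℕ) - 1) * a k < linForm b x ∧
      linForm b x ≤ t + (2 * (j + 1 : ℕ) + 1) * a k) fun x hx => by
    rw [hb, linForm_update_zero]
    push_cast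
    rcases Int.units_eq_one_or (x k) with h | h
    · left
      simp only [h, Units.val_one, Int.cast_one, mul_one]
      constructor <;> linarith [hx.1, hx.2]
    · right
      simp only [h, Units.val_neg, Units.val_one, Int.cast_neg, Int.cast_one, mul_neg, mul_one]
      constructor <;> linarith [hx.1, hx.2]
  linarith

lemma mul_min_le_influence (ha0 : ∀ i, 0 ≤ a i) (hk : ∀ i, a i ≤ a k) (hpos : 0 < a k)
    (ha : ∑ i, a i ^ 2 = 1) (ht : 0 ≤ t) (hp : 0 < prob fun x => t < linForm a x)
    (hp2 : (prob fun x => t < linForm a x) ≤ 1 / 2) (hL0 : 0 < L)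
    (hL : L ^ 2 = Real.log (1 / prob fun x => t < linForm a x)) :
    1 / 128 * (prob fun x => t < linForm a x) * min 1 (a k * L) ≤ influence (halfspace a t) k := by
  -- The distance 6 / L gives the ratio 16/36, below 1/2.
  have h1 := prob_linForm_gt_add_mul_log_le a ha t (δ := 6 / L) (by positivity) hp hp2
  rw [← hL] at h1
  set p := prob fun x => t < linForm a x with hpdef
  set I := influence (halfspace a t) k with hI
  have hI0 : 0 ≤ I := influence_nonneg _ _
  have h2 : (prob fun x => t + 6 / L < linForm a x) ≤ p / 2 := by
    have e : 16 / (6 / L) ^ 2 * p = 16 / 36 * p * L ^ 2 := by field_simp; norm_num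
    rw [e] at h1
    have := le_of_mul_le_mul_right h1 (by positivity)
    linarith
  set N := ⌈6 / L / (2 * a k)⌉₊ with hN
  have hN1 : 6 / L / (2 * a k) ≤ N := Nat.le_ceil _
  have hN2 : (N : ℝ) < 6 / L / (2 * a k) + 1 := Nat.ceil_lt_add_one (by positivity)
  have h3 := prob_le_sum (range N)
    (fun (j : ℕ) (x : Cube n) => t + 2 * j * a k < linForm a x ∧ linForm a x ≤ t + 2 * (j + 1) * a k)
    (fun x => t < linForm a x ∧ linForm a x ≤ t + 6 / L) fun x hx => by
      have hy : 0 < (linForm a x - t) / (2 * a k) := div_pos (by linarith [hx.1]) (by positivity)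
      obtain ⟨j, hj⟩ := Nat.exists_eq_succ_of_ne_zero (Nat.ceil_pos.2 hy).ne'
      have hc1 := Nat.le_ceil ((linForm a x - t) / (2 * a k))
      have hc2 := Nat.ceil_lt_add_one hy.le
      have hc3 : ⌈(linForm a x - t) / (2 * a k)⌉₊ ≤ N := by
        refine Nat.ceil_mono ?_
        gcongr
        linarith [hx.2]
      rw [hj] at hc1 hc2 hc3
      push_cast at hc1 hc2
      refine ⟨j, mem_range.2 hc3, ?_, ?_⟩
      · have : (j : ℝ) < (linForm a x - t) / (2 * a k) := by linarith
        rw [lt_div_iff₀ (by positivity)] at this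
        linarith
      · rw [div_le_iff₀ (by positivity)] at hc1
        linarith
  have h4 : ∑ j ∈ range N, prob (fun x : Cube n => t + 2 * j * a k < linForm a x ∧
      linForm a x ≤ t + 2 * (j + 1) * a k) ≤ ∑ _j ∈ range N, 16 * I :=
    sum_le_sum fun j _ => prob_window_le_sixteen_mul_influence ha0 hk hpos ht j
  rw [sum_const, card_range, nsmul_eq_mul] at h4
  have h5 := prob_le_add (A := fun x => t < linForm a x)
    (B := fun x => t < linForm a x ∧ linForm a x ≤ t + 6 / L)
    (C := fun x => t + 6 / L < linForm a x) fun x hx => by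
      rcases le_or_gt (linForm a x) (t + 6 / L) with h | h
      · exact Or.inl ⟨hx, h⟩
      · exact Or.inr h
  have h6 : p ≤ 32 * (N * I) := by linarith
  have haL : 0 < a k * L := by positivity
  have h7 : N * min 1 (a k * L) ≤ 4 := by
    have e1 : 0 ≤ min 1 (a k * L) := le_min zero_le_one haL.le
    have e2 : 6 / L / (2 * a k) * min 1 (a k * L) ≤ 6 / L / (2 * a k) * (a k * L) := by
      gcongr
      exact min_le_right _ _
    have e3 : 6 / L / (2 * a k) * (a k * L) = 3 := by field_simp; norm_num
    have e4 := min_le_left 1 (a k * L)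
    nlinarith
  have h8 : p * min 1 (a k * L) ≤ 32 * (N * I) * min 1 (a k * L) := by gcongr
  have h9 : 32 * (N * I) * min 1 (a k * L) ≤ 32 * I * 4 := by
    rw [show 32 * (N * I) * min 1 (a k * L) = 32 * I * (N * min 1 (a k * L)) by ring]
    gcongr
  linarith

lemma prob_window_above_le (ha0 : ∀ i, 0 ≤ a i) (hk : ∀ i, a i ≤ a k) (hpos : 0 < a k)
    (ha : ∑ i, a i ^ 2 = 1) (ht : 0 ≤ t) (hp : 0 < prob fun x => t < linForm a x)
    (hp2 : (prob fun x => t < linForm a x) ≤ 1 / 2) (hL0 : 0 < L)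
    (hL : L ^ 2 = Real.log (1 / prob fun x => t < linForm a x)) (haL : a k * L ≤ 1 / 128) :
    prob (fun x => t < linForm a x ∧ linForm a x ≤ t + 2 * a k)
      ≤ 1280 * (prob fun x => t < linForm a x) * (a k * L) := by
  have h1 := prob_below_le hpos ha0 hk ha ht hp hp2 hL0 hL haL
  set p := prob fun x => t < linForm a x with hpdef
  set w := prob fun x => t < linForm a x ∧ linForm a x ≤ t + 2 * a k with hw
  have haL0 : 0 < a k * L := by positivity
  -- For such small t the events S > t, S < -t and the interval below t cover the cube, so 1 ≤ p + p
  -- + 5p. Reflection needs the other case.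
  rcases lt_or_ge t (1 / (32 * L) / 2) with h | h
  · have h2 := prob_le_add (A := fun _ : Cube n => True)
      (B := fun x => t < linForm a x ∨ t < linForm a (-x))
      (C := fun x => t - 1 / (32 * L) < linForm a x ∧ linForm a x ≤ t) fun x _ => by
        rw [linForm_neg]
        by_cases h3 : t < linForm a x
        · exact Or.inl (Or.inl h3)
        · by_cases h4 : t < -linForm a x
          · exact Or.inl (Or.inr h4)
          · exact Or.inr ⟨by linarith, not_lt.1 h3⟩
    have h3 := prob_le_add (A := fun x => t < linForm a x ∨ t < linForm a (-x))
      (B := fun x => t < linForm a x) (C := fun x => t < linForm a (-x)) fun x hx => hx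
    have h4 := prob_comp_neg_le fun x => t < linForm a x
    rw [prob_true] at h2
    have h5 : 1 ≤ 7 * p := by linarith
    have h6 : w ≤ 72 * a k := by
      refine le_trans (prob_mono fun x hx => ?_)
        (prob_abs_linForm_sub_le hpos ha0 hk ha (t + a k))
      rw [abs_le]
      constructor <;> linarith [hx.1, hx.2]
    have hL2 : 1 / 2 ≤ L := by
      have : 1 / 2 ≤ L ^ 2 := by
        rw [hL]
        have e1 : Real.log 2 ≤ Real.log (1 / p) := Real.log_le_log two_pos (by
          rw [le_div_iff₀ hp]; linarith)
        have := Real.log_two_gt_d9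
        linarith
      nlinarith
    calc w ≤ 72 * a k := h6
      _ ≤ 72 * (a k * (2 * L)) := by
          have := le_mul_of_one_le_right hpos.le (show 1 ≤ 2 * L by linarith)
          linarith
      _ ≤ 72 * (a k * (2 * L)) * (7 * p) := le_mul_of_one_le_right (by positivity) h5
      _ = 1008 * (p * (a k * L)) := by ring
      _ ≤ 1280 * (p * (a k * L)) := by gcongr; norm_num
      _ = _ := by ring
  · set δ := 1 / (32 * L) with hδ
    set N := ⌊δ / (4 * a k)⌋₊ with hN
    have e0 : δ / (4 * a k) = 1 / (128 * (a k * L)) := by rw [hδ]; field_simp; norm_num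
    have e1 : 1 ≤ δ / (4 * a k) := by
      rw [e0, le_div_iff₀ (by positivity)]; linarith
    have hN1 : (N : ℝ) ≤ δ / (4 * a k) := Nat.floor_le (by linarith)
    have hN2 : δ / (4 * a k) < N + 1 := Nat.lt_floor_add_one _
    have hN3 : (1 : ℝ) ≤ N := by exact_mod_cast Nat.le_floor (by exact_mod_cast e1)
    have hN4 : δ / (4 * a k) ≤ 2 * N := by linarith
    have hN5 : N * (4 * a k) ≤ δ := by rwa [le_div_iff₀ (by positivity)] at hN1
    have h2 := sum_prob_le (range N)
      (fun (j : ℕ) (x : Cube n) => t - (4 * j + 4) * a k < linForm a x ∧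
        linForm a x ≤ t - 4 * j * a k)
      (fun x => t - δ < linForm a x ∧ linForm a x ≤ t)
      (fun j hj x hx => by
        have hj' : (j : ℝ) + 1 ≤ N := by exact_mod_cast mem_range.1 hj
        have e2 : ((j : ℝ) + 1) * (4 * a k) ≤ N * (4 * a k) := by gcongr
        have e3 : 0 ≤ 4 * (j : ℝ) * a k := by positivity
        constructor <;> linarith [hx.1, hx.2])
      (fun i _ j _ x hi hj => by
        have key : ∀ i j : ℕ, t - (4 * i + 4) * a k < linForm a x → linForm a x ≤ t - 4 * j * a k →
            j ≤ i := by
          intro i j h3 h4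
          have h5 : ((j : ℝ) - (i + 1)) * (4 * a k) < 0 := by linarith
          have h6 : (j : ℝ) - (i + 1) < 0 := by
            by_contra! h7
            have := mul_nonneg h7 (show 0 ≤ 4 * a k by positivity)
            linarith
          have : (j : ℝ) < ((i + 1 : ℕ) : ℝ) := by push_cast; linarith
          have := Nat.cast_lt.1 this
          omega
        exact le_antisymm (key j i hj.1 hi.2) (key i j hi.1 hj.2))
    have h3 : ∑ _j ∈ range N, w ≤ ∑ j ∈ range N, prob (fun x : Cube n =>
        t - (4 * j + 4) * a k < linForm a x ∧ linForm a x ≤ t - 4 * j * a k) := by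
      refine sum_le_sum fun j hj => ?_
      have hj' : (j : ℝ) + 1 ≤ N := by exact_mod_cast mem_range.1 hj
      have e2 : ((j : ℝ) + 1) * (4 * a k) ≤ N * (4 * a k) := by gcongr
      -- This level sends (t, t + 2a_k] into the jth window, of length 4a_k because of the
      -- overshoot. It is at most δ/2, hence at most t.
      refine (prob_interval_le_shift hpos.le ha0 hk (r := (2 * j + 1) * a k) (α := t)
        (by positivity) (by linarith) (2 * a k)).trans (prob_mono fun x hx => ?_)
      constructor <;> linarith [hx.1, hx.2]
    rw [sum_const, card_range, nsmul_eq_mul] at h3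
    have hw0 : 0 ≤ w := prob_nonneg _
    have h4 : δ / (4 * a k) * w ≤ 10 * p := by
      have := mul_le_mul_of_nonneg_right hN4 hw0
      linarith
    rw [e0, div_mul_eq_mul_div, one_mul, div_le_iff₀ (by positivity)] at h4
    linarith

lemma influence_le_mul_min (ha0 : ∀ i, 0 ≤ a i) (hk : ∀ i, a i ≤ a k) (hpos : 0 < a k)
    (ha : ∑ i, a i ^ 2 = 1) (ht : 0 ≤ t) (hp : 0 < prob fun x => t < linForm a x)
    (hp2 : (prob fun x => t < linForm a x) ≤ 1 / 2) (hL0 : 0 < L)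
    (hL : L ^ 2 = Real.log (1 / prob fun x => t < linForm a x)) (i : Fin n) :
    influence (halfspace a t) i ≤ 2560 * (prob fun x => t < linForm a x) * min 1 (a k * L) := by
  have h1 := influence_halfspace_le (ha0 i) t
  rcases le_or_gt (a k * L) (1 / 128) with h | h
  · have h2 := prob_window_above_le ha0 hk hpos ha ht hp hp2 hL0 hL h
    have h3 : (prob fun x => t < linForm a x ∧ linForm a x ≤ t + 2 * a i)
        ≤ prob fun x => t < linForm a x ∧ linForm a x ≤ t + 2 * a k :=
      prob_mono fun x hx => ⟨hx.1, by linarith [hx.2, hk i]⟩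
    rw [min_eq_right (by linarith)]
    linarith
  · have h2 : (prob fun x => t < linForm a x ∧ linForm a x ≤ t + 2 * a i)
        ≤ prob fun x => t < linForm a x := prob_mono fun x hx => hx.1
    have h3 : 1 / 128 ≤ min 1 (a k * L) := le_min (by norm_num) h.le
    have h4 := mul_le_mul_of_nonneg_left h3 hp.le
    linarith

end Bounds

end

theorem theorem3 :
    ∃ c₁ c₂ : ℝ, 0 < c₁ ∧ 0 < c₂ ∧
      ∀ (n : ℕ) [NeZero n] (a : Fin n → ℝ) (t : ℝ),
        Antitone a → (∀ i, 0 ≤ a i) → ∑ i, a i ^ 2 = 1 →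
        cubeMean (halfspace a t) ≤ 1 / 2 →
          c₁ * cubeMean (halfspace a t) *
              min 1 (a 0 * √(Real.log (1 / cubeMean (halfspace a t)))) ≤
            maxInfluence (halfspace a t) ∧
          maxInfluence (halfspace a t) ≤
            c₂ * cubeMean (halfspace a t) *
              min 1 (a 0 * √(Real.log (1 / cubeMean (halfspace a t)))) := by
  refine ⟨1 / 128, 2560, by norm_num, by norm_num, fun n _ a t hanti ha0 ha hE => ?_⟩
  wlog ht : 0 ≤ t generalizing t
  · have e := halfspace_eq_halfspace_zero (not_le.1 ht) hE
    rw [e] at hE ⊢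
    exact this 0 hE le_rfl
  have hk : ∀ i, a i ≤ a 0 := fun i => hanti (Fin.zero_le i)
  have hpos : 0 < a 0 := by
    refine (ha0 0).lt_of_ne fun h => ?_
    have h0 : ∀ i, a i = 0 := fun i => le_antisymm ((hk i).trans h.symm.le) (ha0 i)
    simp [h0] at ha
  have hmax : influence (halfspace a t) 0 ≤ maxInfluence (halfspace a t) :=
    le_sup' (influence (halfspace a t)) (mem_univ 0)
  rw [cubeMean_halfspace] at hE ⊢
  rcases (prob_nonneg fun x => t < linForm a x).eq_or_lt with hp | hp
  -- The factor p = 0 annihilates both outer terms, whatever value log(1/0) is given.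
  · rw [← hp]
    simp only [mul_zero, zero_mul]
    refine ⟨(influence_nonneg _ _).trans hmax, sup'_le _ _ fun i _ => ?_⟩
    have h1 := influence_halfspace_le (ha0 i) t
    have h2 : (prob fun x => t < linForm a x ∧ linForm a x ≤ t + 2 * a i)
        ≤ prob fun x => t < linForm a x := prob_mono fun x hx => hx.1
    linarith
  · have hlog : 0 < Real.log (1 / prob fun x => t < linForm a x) :=
      Real.log_pos (by rw [lt_div_iff₀ hp]; linarith)
    have hL := Real.sq_sqrt hlog.le
    have hL0 := Real.sqrt_pos.2 hlog
    exact ⟨(mul_min_le_influence ha0 hk hpos ha ht hp hE hL0 hL).trans hmax,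
      sup'_le _ _ fun i _ => influence_le_mul_min ha0 hk hpos ha ht hp hE hL0 hL i⟩
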